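/- Let $D$ be a connected 1-linkoid diagram in $S^2$: the image of a generic immersion of one unit interval and finitely many circles, with finitely many double points (crossings), none of them an endpoint of the interval. The endpoints are called the tail and the head. Put a star in the region adjacent to the tail, and draw $D$ in the plane so that the starred region is the unbounded one. A clock state of $D$ places one marker at each crossing, in one of the four local corners there, so that each unstarred region receives exactly one marker and the starred region receives none. A clockwise clock move on a clock state is one of the following, provided that the result is again a clock state: (i) one marker is rotated clockwise by $90^\circ$ around its crossing and stays in its region (it moves across an edge which has this region on both sides and leads towards the head, possibly through a further portion of the diagram); (ii) two markers, lying in distinct regions that share a common boundary, are both rotated clockwise by $90^\circ$ around their crossings and thereby swap their regions. Counterclockwise clock moves are the reverses of clockwise ones. Each move is identified by its site, i.e. the one or two half-edges at crossings across which markers are rotated. A state is clocked if it admits no counterclockwise clock move, and counter-clocked if it admits no clockwise clock move. Write $s_2<s_1$ if $s_2$ is obtained from $s_1$ by a nonempty finite sequence of clockwise clock moves. Then: 1. $<$ is the strict order of a partial order on the set of clock states of $D$, and with this order the set of clock states is a lattice. 2. There is exactly one clocked state and exactly one counter-clocked state; they are the greatest and the least element of the lattice. 3. Every state $s$ is reached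 from the clocked state by a sequence of clockwise clock moves, and the multiset $M(s)$ of the moves applied (each move counted as often as it is applied) depends only on $s$. 4. For any states $s_1,s_2$, the supremum of $s_1$ and $s_2$ is the unique state $s$ with $M(s)=M(s_1)\cap M(s_2)$, and the infimum is the unique state $s$ with $M(s)=M(s_1)\cup M(s_2)$ (intersection and union of multisets, i.e. minimum and maximum of multiplicities). -/

import Mathlib

/-- The darts (half-edges) of the universe of a 1-linkoid diagram with set of crossings `C`:
one dart at the tail, one dart at the head, and four darts `strand c 0, …, strand c 3` at each
crossing `c`, listed in counterclockwise order around `c`. -/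
inductive LinkoidDart (C : Type*) where
  | tail : LinkoidDart C
  | head : LinkoidDart C
  | strand (c : C) (i : ZMod 4) : LinkoidDart C

namespace LinkoidDart

variable {C : Type*}

/-- The next dart in counterclockwise order around the same vertex. -/
def rot : Equiv.Perm (LinkoidDart C) where
  toFun
    | tail => tail
    | head => head
    | strand c i => strand c (i + 1)
  invFun
    | tail => tail
    | head => head
    | strand c i => strand c (i - 1)
  left_inv d := by cases d <;> simp
  right_inv d := by cases d <;> simp

/-- Two darts bound the same region on their left side (seen walking away from the vertex) when
they lie in one orbit of this permutation: walk along the edge of `d` to its other end, then turn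
into the next edge keeping the same region on the left. The region on the left of `d` contains the
corner between `d` and `rot d`. -/
def facePerm (arc : Equiv.Perm (LinkoidDart C)) : Equiv.Perm (LinkoidDart C) :=
  rot⁻¹ * arc

end LinkoidDart

/-- A connected 1-linkoid diagram on the sphere (up to orientation preserving homeomorphism),
with finite set of crossings `C`, presented by its universe as a plane map: the four-valent
vertices are the crossings, the two one-valent vertices are the tail and the head, `arc` exchanges
the two darts of every edge, the cyclic order at the vertices is `LinkoidDart.rot`, the map is
connected, and it lies on the sphere. The underlying immersed curve passes straight through every
crossing: dart `i` continues in dart `i + 2`. -/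
structure OneLinkoidDiagram (C : Type*) [Fintype C] where
  /-- The other dart of the same edge. -/
  arc : Equiv.Perm (LinkoidDart C)
  arc_arc : ∀ d, arc (arc d) = d
  arc_ne : ∀ d, arc d ≠ d
  connected : ∀ d e, Relation.EqvGen (fun x y => y = arc x ∨ y = LinkoidDart.rot x) d e
  /-- Euler's formula `V - E + F = 2`, with `V = |C| + 2` vertices, `E = (4 |C| + 2) / 2` edges. -/
  euler : ((Fintype.card C + 2 : ℕ) : ℤ) - ((2 * Fintype.card C + 1 : ℕ) : ℤ)
    + (Nat.card (Quotient (Equiv.Perm.SameCycle.setoid (LinkoidDart.facePerm arc))) : ℤ) = 2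
  /-- Crossing information: `isOver c = true` when the strand through the darts `0` and `2` at `c`
  passes over the strand through the darts `1` and `3`. Clock states do not depend on it. -/
  isOver : C → Bool

namespace OneLinkoidDiagram

variable {C : Type*} [Fintype C] (D : OneLinkoidDiagram C)

/-- The regions (faces) of the universe in the sphere. -/
def Region : Type _ :=
  Quotient (Equiv.Perm.SameCycle.setoid (LinkoidDart.facePerm D.arc))

/-- The region on the left of a dart. -/
def leftRegion (d : LinkoidDart C) : D.Region :=
  Quotient.mk (Equiv.Perm.SameCycle.setoid (LinkoidDart.facePerm D.arc)) d

/-- The region that contains the local corner `i` of the crossing `c`, that is, the corner between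
the darts `i` and `i + 1` at `c`. -/
def cornerRegion (c : C) (i : ZMod 4) : D.Region :=
  D.leftRegion (LinkoidDart.strand c i)

/-- The starred region: the one adjacent to the tail. In the standard planar representation it is
the exterior (unbounded) region. -/
def starRegion : D.Region :=
  D.leftRegion LinkoidDart.tail

/-- A clock state: a marker in one of the four local corners of each crossing, such that each
unstarred region receives exactly one marker and the starred region receives none. -/
@[ext]
structure ClockState where
  /-- The local corner that holds the marker at a crossing. -/
  marker : C → ZMod 4
  bijOn : Set.BijOn (fun c => D.cornerRegion c (marker c)) Set.univ {r | r ≠ D.starRegion}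

variable {D}

/-- The region that holds the marker at the crossing `c`. -/
def ClockState.regionAt (s : D.ClockState) (c : C) : D.Region :=
  D.cornerRegion c (s.marker c)

variable [DecidableEq C]

/-- `s'` is obtained from `s` by one clockwise clock move. Rotating a marker clockwise by 90 degrees
takes it from corner `i` to corner `i - 1`, across the dart `i`. Either
* one marker rotates and stays in its region (so it moves across an edge which has the same region
  on both sides, and which leads to the head), or
* the markers at two crossings rotate and swap their regions (so these are distinct regions, and
  they share the edges across which the markers move).

The finite set `X` records the site of the move, namely the dart or the two darts across which
markers move. -/
def ClockwiseMove (s s' : D.ClockState) (X : Finset (C × ZMod 4)) : Prop :=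
  (∃ c, X = {(c, s.marker c)} ∧
    (∀ x, s'.marker x = if x = c then s.marker x - 1 else s.marker x) ∧
    s'.regionAt c = s.regionAt c) ∨
  (∃ c d, c ≠ d ∧ X = {(c, s.marker c), (d, s.marker d)} ∧
    (∀ x, s'.marker x = if x = c ∨ x = d then s.marker x - 1 else s.marker x) ∧
    s.regionAt c ≠ s.regionAt d ∧
    s'.regionAt c = s.regionAt d ∧ s'.regionAt d = s.regionAt c)

/-- `s'` is obtained from `s` by one counterclockwise clock move, the reverse of a clockwise one. -/
def CounterclockwiseMove (s s' : D.ClockState) (X : Finset (C × ZMod 4)) : Prop :=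
  ClockwiseMove s' s X

/-- A clocked state admits clock moves only in the clockwise direction. -/
def ClockState.IsClocked (s : D.ClockState) : Prop :=
  ∀ s' X, ¬ CounterclockwiseMove s s' X

/-- A counter-clocked state admits clock moves only in the counterclockwise direction. -/
def ClockState.IsCounterClocked (s : D.ClockState) : Prop :=
  ∀ s' X, ¬ ClockwiseMove s s' X

/-- `ReachedBy s t M`: some finite sequence of clockwise clock moves leads from `s` to `t`, and `M`
is the multiset of the sites of its moves (each site counted as often as it is used). -/
inductive ReachedBy (s : D.ClockState) : D.ClockState → Multiset (Finset (C × ZMod 4)) → Prop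
  | refl : ReachedBy s s 0
  | step {t u : D.ClockState} {M : Multiset (Finset (C × ZMod 4))} {X : Finset (C × ZMod 4)} :
      ReachedBy s t M → ClockwiseMove t u X → ReachedBy s u (X ::ₘ M)

/-- `s` is obtained from the state `t` by the intersection of the clockwise moves which lead from
`t` to `s₁` and to `s₂`. -/
def IsMoveSup (t s₁ s₂ s : D.ClockState) : Prop :=
  ∃ M₁ M₂, ReachedBy t s₁ M₁ ∧ ReachedBy t s₂ M₂ ∧ ReachedBy t s (M₁ ∩ M₂)

/-- `s` is obtained from the state `t` by the union of the clockwise moves which lead from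
`t` to `s₁` and to `s₂`. -/
def IsMoveInf (t s₁ s₂ s : D.ClockState) : Prop :=
  ∃ M₁ M₂, ReachedBy t s₁ M₁ ∧ ReachedBy t s₂ M₂ ∧ ReachedBy t s (M₁ ∪ M₂)

end OneLinkoidDiagram

/-!
The clock moves form a confluent system in both directions, and everything else follows from this
together with one fact of planar topology.

*Confluence.* The marker which can swap regions with the marker at a crossing `c` under a quarter
turn is determined by the state, since it lies in the region next to that of `c`. Hence two moves
from one state are equal or take place at disjoint crossings and commute
(`OneLinkoidDiagram.ClockState.Turn.comm`), and the same holds for reversed moves. A finite acyclic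
system of labelled steps with this diamond property in both directions, and with only one terminal
point, is a lattice as described (`exists_lattice_of_labelledDiamond`): two paths `A`, `B` from one
point are completed by `B - A` and `A - B` to a common end, which gives infima as unions, and
suprema as intersections when applied to reversed paths. What has to be shown is that states exist,
that the moves are acyclic, and that only one state admits no clockwise move.

*Planarity.* Euler's formula says that the sphere has no harmonic 1-forms: each function on
corners is a difference of potentials on vertices and regions plus a difference of a potential on
edges (`exists_cornerDiff_add_edgeDiff`). Cutting the universe open at a nonempty set `P` of
crossings, and counting the pieces by means of this, yields a Hall condition: `P` is adjacent to at
least `|P| + 1` regions (`card_lt_card_adjacentRegions`), and in the case of equality each piece has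
exactly two ends (`card_ports_eq_two`). By the marriage theorem there is a clock state.

*Heights.* The markers of two states differ by the differences of a function on edges, the height.
By the Hall condition a clockwise move never lowers the height (`ClockState.IsHeight.nonneg`), so
the moves are acyclic. If some state has positive height over `s` at some edge, then the edges of
positive height form a set `A` which avoids the tail and is closed under passing counterclockwise to
the next edge at a crossing, except across a marker of `s`. A smallest set of this kind without
holes meets each crossing in all four darts or at most in the dart under the marker; otherwise it
would contain a closed directed walk around some part of its outside, contrary to the Hall
condition (`ClockState.IsForwardClosed.not_reachable`). Then the Hall condition is sharp for the
crossings which are not surrounded by `A`, so that a piece of `A` ends at one or two of them, and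
their markers can be rotated clockwise (`ClockState.exists_rotatable`). Hence two states without
clockwise moves have height zero over one another, and are equal.
-/

/-! ### Labelled confluent systems -/

/-- `LabelledPath step s t M`: a finite sequence of steps leads from `s` to `t`, and `M` is the
multiset of their labels. -/
inductive LabelledPath {S L : Type*} (step : S → S → L → Prop) (s : S) : S → Multiset L → Prop
  | refl : LabelledPath step s s 0
  | snoc {t u : S} {M : Multiset L} {X : L} :
      LabelledPath step s t M → step t u X → LabelledPath step s u (X ::ₘ M)

/-- A labelled relation has the labelled diamond property when a label determines the step taken
from a given point, and two steps with distinct labels from one point commute. -/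
structure LabelledDiamond {S L : Type*} (step : S → S → L → Prop) : Prop where
  det : ∀ {s a b X}, step s a X → step s b X → a = b
  comm : ∀ {s a b X Y}, step s a X → step s b Y → X ≠ Y → ∃ u, step a u Y ∧ step b u X

namespace LabelledPath

variable {S L : Type*} {step : S → S → L → Prop} {s t u : S} {M N : Multiset L}

theorem trans (h : LabelledPath step s t M) (h' : LabelledPath step t u N) :
    LabelledPath step s u (M + N) := by
  induction h' with
  | refl => simpa using h
  | snoc _ hs ih => rw [Multiset.add_cons]; exact ih.snoc hs

theorem single {X : L} (h : step s t X) : LabelledPath step s t {X} := by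
  simpa using LabelledPath.refl.snoc h

theorem reverse (h : LabelledPath step s t M) :
    LabelledPath (fun a b X => step b a X) t s M := by
  induction h with
  | refl => exact .refl
  | @snoc v u M X _ hs ih =>
    have := (single (step := fun a b X => step b a X) hs).trans ih
    simpa using this

theorem eq_of_zero (h : LabelledPath step s t 0) : t = s := by
  generalize hM : (0 : Multiset L) = M at h
  cases h with
  | refl => rfl
  | snoc _ _ => exact absurd hM (Multiset.zero_ne_cons)

theorem eq_of_terminal (hs : ∀ u X, ¬ step s u X) (h : LabelledPath step s t M) :
    t = s ∧ M = 0 := by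
  induction h with
  | refl => exact ⟨rfl, rfl⟩
  | snoc _ h' ih => rw [ih.1] at h'; exact absurd h' (hs _ _)

theorem transGen_iff :
    Relation.TransGen (fun a b => ∃ X, step a b X) s t ↔
      ∃ M, M ≠ 0 ∧ LabelledPath step s t M := by
  constructor
  · intro h
    induction h with
    | single h => obtain ⟨X, h⟩ := h; exact ⟨{X}, by simp, .single h⟩
    | tail _ h ih =>
      obtain ⟨X, h⟩ := h
      obtain ⟨M, -, hp⟩ := ih
      exact ⟨X ::ₘ M, by simp, hp.snoc h⟩
  · rintro ⟨M, hM, h⟩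
    induction h with
    | refl => exact absurd rfl hM
    | @snoc v u M X hp h ih =>
      by_cases h0 : M = 0
      · subst h0
        rw [hp.eq_of_zero] at h
        exact .single ⟨X, h⟩
      · exact (ih h0).tail ⟨X, h⟩

variable [DecidableEq L]

/-- A step commutes past a path, unless the path already uses its label: then the step can be
taken first. -/
theorem residual_step (hd : LabelledDiamond step) {a : S} {X : L} (hX : step s a X)
    (h : LabelledPath step s t M) :
    (X ∈ M ∧ LabelledPath step a t (M.erase X)) ∨
      (X ∉ M ∧ ∃ w, LabelledPath step a w M ∧ step t w X) := by
  induction h with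
  | refl => exact .inr ⟨by simp, a, .refl, hX⟩
  | @snoc v u M Y _ hY ih =>
    rcases ih with ⟨hm, hp⟩ | ⟨hm, w, hp, hw⟩
    · left
      refine ⟨Multiset.mem_cons_of_mem hm, ?_⟩
      by_cases hXY : Y = X
      · subst hXY
        rw [Multiset.erase_cons_head, ← Multiset.cons_erase hm]
        exact hp.snoc hY
      · rw [Multiset.erase_cons_tail _ hXY]
        exact hp.snoc hY
    · by_cases hXY : X = Y
      · subst hXY
        left
        rw [hd.det hY hw]
        exact ⟨by simp, by simpa using hp⟩
      · right
        obtain ⟨x, h1, h2⟩ := hd.comm hw hY hXY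
        exact ⟨by simp [hXY, hm], x, hp.snoc h1, h2⟩

/-- Two paths from one point are completed to a common end, each by the labels which it lacks. -/
theorem residual (hd : LabelledDiamond step) {a b : S} {A B : Multiset L}
    (hA : LabelledPath step s a A) (hB : LabelledPath step s b B) :
    ∃ w, LabelledPath step a w (B - A) ∧ LabelledPath step b w (A - B) := by
  induction hA with
  | refl => exact ⟨b, by simpa using hB, by simpa using LabelledPath.refl⟩
  | @snoc v u A X _ hX ih =>
    obtain ⟨w, h1, h2⟩ := ih
    rcases residual_step hd hX h1 with ⟨hm, hp⟩ | ⟨hm, x, hp, hx⟩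
    · refine ⟨w, ?_, ?_⟩
      · convert hp using 1
        ext Y
        simp only [Multiset.count_sub, Multiset.count_cons]
        split_ifs with hY
        · subst hY; simp only [Multiset.count_erase_self, Multiset.count_sub]; omega
        · rw [Multiset.count_erase_of_ne hY, Multiset.count_sub]; omega
      · convert h2 using 1
        have := Multiset.count_pos.2 hm
        ext Y
        simp only [Multiset.count_sub, Multiset.count_cons] at this ⊢
        split_ifs with hY
        · subst hY; omega
        · omega
    · refine ⟨x, ?_, ?_⟩
      · convert hp using 1
        have := Multiset.count_eq_zero.2 hm
        ext Y
        simp only [Multiset.count_sub, Multiset.count_cons] at this ⊢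
        split_ifs with hY
        · subst hY; omega
        · omega
      · convert h2.snoc hx using 1
        have := Multiset.count_eq_zero.2 hm
        ext Y
        simp only [Multiset.count_sub, Multiset.count_cons] at this ⊢
        split_ifs with hY
        · subst hY; omega
        · omega

end LabelledPath

theorem exists_terminal_of_rank {S L : Type*} [Finite S] {step : S → S → L → Prop} {Φ : S → ℚ}
    (hΦ : ∀ {a b X}, step a b X → Φ a < Φ b) (s : S) :
    ∃ b M, LabelledPath step s b M ∧ ∀ u X, ¬ step b u X := by
  obtain ⟨b, ⟨M, hb⟩, hmax⟩ := Set.exists_max_image {b | ∃ M, LabelledPath step s b M} Φ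
    (Set.toFinite _) ⟨s, 0, .refl⟩
  exact ⟨b, M, hb, fun u X h => (hΦ h).not_ge (hmax u ⟨_, hb.snoc h⟩)⟩

/-- A finite acyclic system of labelled steps with the diamond property in both directions and
with only one terminal point is a lattice under reachability, in which the multiset of labels used
on the way from the top turns suprema into intersections and infima into unions. -/
theorem exists_lattice_of_labelledDiamond {S L : Type*} [DecidableEq L] [Finite S] [Nonempty S]
    {step : S → S → L → Prop} (hf : LabelledDiamond step)
    (hb : LabelledDiamond (fun s t X => step t s X)) {Φ : S → ℚ}
    (hΦ : ∀ {a b X}, step a b X → Φ a < Φ b)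
    (huniq : ∀ s t, (∀ u X, ¬ step s u X) → (∀ u X, ¬ step t u X) → s = t) :
    ∃ _ : Lattice S,
      (∀ s₁ s₂ : S, s₂ < s₁ ↔ Relation.TransGen (fun s s' => ∃ X, step s s' X) s₁ s₂) ∧
      ∃ t b : S,
        (∀ s : S, (∀ s' X, ¬ step s' s X) ↔ s = t) ∧
        (∀ s : S, (∀ s' X, ¬ step s s' X) ↔ s = b) ∧
        IsTop t ∧ IsBot b ∧
        (∀ s : S, ∃! M, LabelledPath step t s M) ∧
        (∀ s₁ s₂ s : S, (∃ M₁ M₂, LabelledPath step t s₁ M₁ ∧ LabelledPath step t s₂ M₂ ∧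
          LabelledPath step t s (M₁ ∩ M₂)) ↔ s = s₁ ⊔ s₂) ∧
        (∀ s₁ s₂ s : S, (∃ M₁ M₂, LabelledPath step t s₁ M₁ ∧ LabelledPath step t s₂ M₂ ∧
          LabelledPath step t s (M₁ ∪ M₂)) ↔ s = s₁ ⊓ s₂) := by
  classical
  obtain ⟨s₀⟩ := ‹Nonempty S›
  obtain ⟨b, -, -, hbot⟩ := exists_terminal_of_rank (step := step) hΦ s₀
  have toBot : ∀ s, ∃ N, LabelledPath step s b N := by
    intro s
    obtain ⟨b', N, h, hb'⟩ := exists_terminal_of_rank (step := step) hΦ s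
    exact ⟨N, huniq b' b hb' hbot ▸ h⟩
  have hΦ' : ∀ {a b X}, step b a X → -Φ a < -Φ b := fun h => neg_lt_neg (hΦ h)
  obtain ⟨t, -, -, htop⟩ :=
    exists_terminal_of_rank (step := fun s t X => step t s X) (Φ := fun s => -Φ s) hΦ' s₀
  -- Every point reaches `b`, so backward confluence makes the initial point unique.
  have initial_unique : ∀ t', (∀ u X, ¬ step u t' X) → t' = t := by
    intro t' ht'
    obtain ⟨N, hN⟩ := toBot t
    obtain ⟨N', hN'⟩ := toBot t'
    obtain ⟨w, h1, h2⟩ := LabelledPath.residual hb hN.reverse hN'.reverse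
    rw [← (h1.eq_of_terminal htop).1, ← (h2.eq_of_terminal ht').1]
  have fromTop : ∀ s, ∃ M, LabelledPath step t s M := by
    intro s
    obtain ⟨t', N, h, ht'⟩ :=
      exists_terminal_of_rank (step := fun s t X => step t s X) (Φ := fun s => -Φ s) hΦ' s
    exact ⟨N, initial_unique t' ht' ▸ h.reverse⟩
  have unique_to_bot : ∀ {s A B}, LabelledPath step s b A → LabelledPath step s b B → A = B := by
    intro s A B hA hB
    obtain ⟨w, h1, h2⟩ := LabelledPath.residual hf hA hB
    exact le_antisymm (tsub_eq_zero_iff_le.1 (h2.eq_of_terminal hbot).2)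
      (tsub_eq_zero_iff_le.1 (h1.eq_of_terminal hbot).2)
  have unique : ∀ {r s A B}, LabelledPath step r s A → LabelledPath step r s B → A = B := by
    intro r s A B hA hB
    obtain ⟨N, hN⟩ := toBot s
    exact add_right_cancel (unique_to_bot (hA.trans hN) (hB.trans hN))
  choose M hM using fromTop
  choose N hN using toBot
  have hMN : ∀ s, M s + N s = N t := fun s => unique ((hM s).trans (hN s)) (hN t)
  have reach_iff : ∀ r s, (∃ A, LabelledPath step r s A) ↔ M r ≤ M s := by
    intro r s
    constructor
    · rintro ⟨A, hA⟩
      rw [unique (hM s) ((hM r).trans hA)]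
      exact Multiset.le_add_right _ _
    · intro h
      obtain ⟨w, h1, h2⟩ := LabelledPath.residual hf (hM r) (hM s)
      rw [tsub_eq_zero_iff_le.2 h] at h2
      exact ⟨_, h2.eq_of_zero ▸ h1⟩
  have M_inj : ∀ r s, M r = M s → r = s := by
    intro r s h
    obtain ⟨w, h1, h2⟩ := LabelledPath.residual hf (hM r) (hM s)
    rw [h, tsub_self] at h1 h2
    exact h1.eq_of_zero.symm.trans h2.eq_of_zero
  have exists_inf : ∀ r s, ∃ w, M w = M r ∪ M s := by
    intro r s
    obtain ⟨w, h1, -⟩ := LabelledPath.residual hf (hM r) (hM s)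
    refine ⟨w, ?_⟩
    rw [unique (hM w) ((hM r).trans h1)]
    ext Y
    simp only [Multiset.count_add, Multiset.count_sub, Multiset.count_union]
    omega
  have exists_sup : ∀ r s, ∃ w, M w = M r ∩ M s := by
    intro r s
    obtain ⟨w, h1, -⟩ := LabelledPath.residual hb (hN r).reverse (hN s).reverse
    refine ⟨w, ?_⟩
    have h2 := unique (hM r) ((hM w).trans h1.reverse)
    ext Y
    have e1 := congrArg (Multiset.count Y) h2
    have e2 := congrArg (Multiset.count Y) (hMN r)
    have e3 := congrArg (Multiset.count Y) (hMN s)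
    simp only [Multiset.count_add, Multiset.count_sub, Multiset.count_inter] at e1 e2 e3 ⊢
    omega
  choose inf hinf using exists_inf
  choose sup hsup using exists_sup
  let order : PartialOrder S :=
    { le := fun s r => M r ≤ M s
      le_refl := fun _ => le_rfl
      le_trans := fun _ _ _ h h' => h'.trans h
      le_antisymm := fun r s h h' => M_inj r s (le_antisymm h' h) }
  let lattice : Lattice S :=
    { order with
      sup := sup
      inf := inf
      le_sup_left := fun r s => (hsup r s).trans_le (Multiset.inter_le_left)
      le_sup_right := fun r s => (hsup r s).trans_le (Multiset.inter_le_right)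
      sup_le := fun r s w h h' => (Multiset.le_inter h h').trans_eq (hsup r s).symm
      inf_le_left := fun r s => (Multiset.le_union_left).trans_eq (hinf r s).symm
      inf_le_right := fun r s => (Multiset.le_union_right).trans_eq (hinf r s).symm
      le_inf := fun r s w h h' => (hinf s w).trans_le (Multiset.union_le h h') }
  refine ⟨lattice, ?_, t, b, ?_, ?_, ?_, ?_, ?_, ?_, ?_⟩
  · intro r s
    rw [LabelledPath.transGen_iff]
    constructor
    · intro h
      obtain ⟨A, hA⟩ := (reach_iff r s).2 h.le
      refine ⟨A, ?_, hA⟩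
      rintro rfl
      exact h.ne hA.eq_of_zero
    · rintro ⟨A, hA0, hA⟩
      refine lt_of_le_of_ne ((reach_iff r s).1 ⟨A, hA⟩) ?_
      rintro rfl
      exact hA0 (unique hA .refl)
  · exact fun s => ⟨initial_unique s, fun h => h ▸ htop⟩
  · exact fun s => ⟨fun h => huniq s b h hbot, fun h => h ▸ hbot⟩
  · intro s
    exact (reach_iff t s).1 ⟨_, hM s⟩
  · intro s
    exact (reach_iff s b).1 ⟨_, hN s⟩
  · exact fun s => ⟨M s, hM s, fun A hA => unique hA (hM s)⟩
  · intro r s w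
    constructor
    · rintro ⟨A, B, hA, hB, hw⟩
      rw [unique hA (hM r), unique hB (hM s)] at hw
      exact M_inj _ _ ((unique (hM w) hw).trans (hsup r s).symm)
    · rintro rfl
      exact ⟨M r, M s, hM r, hM s, hsup r s ▸ hM _⟩
  · intro r s w
    constructor
    · rintro ⟨A, B, hA, hB, hw⟩
      rw [unique hA (hM r), unique hB (hM s)] at hw
      exact M_inj _ _ ((unique (hM w) hw).trans (hinf r s).symm)
    · rintro rfl
      exact ⟨M r, M s, hM r, hM s, hinf r s ▸ hM _⟩

/-! ### Darts and their vertices, regions and edges -/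

namespace LinkoidDart

variable {C : Type*}

/-- A dart is the tail, the head, or one of the four strands at a crossing. -/
def equivOption : LinkoidDart C ≃ Option (Option (C × ZMod 4)) where
  toFun
    | tail => none
    | head => some none
    | strand c i => some (some (c, i))
  invFun
    | none => tail
    | some none => head
    | some (some (c, i)) => strand c i
  left_inv d := by cases d <;> rfl
  right_inv d := by rcases d with _ | _ | _ <;> rfl

instance [Fintype C] : Fintype (LinkoidDart C) := Fintype.ofEquiv _ equivOption.symm

theorem card_eq [Fintype C] : Fintype.card (LinkoidDart C) = 4 * Fintype.card C + 2 := by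
  rw [Fintype.card_congr (equivOption (C := C))]
  simp [mul_comm, ZMod.card]

theorem sum_eq [Fintype C] {M : Type*} [AddCommMonoid M] (g : LinkoidDart C → M) :
    ∑ d, g d = g tail + (g head + ∑ c, ∑ i, g (strand c i)) := by
  rw [← equivOption.symm.sum_comp, Fintype.sum_option, Fintype.sum_option, Fintype.sum_prod_type]
  rfl

/-- The vertex at which a dart starts: the tail, the head or a crossing. -/
def vertex : LinkoidDart C → Option (Option C)
  | tail => none
  | head => some none
  | strand c _ => some (some c)

@[simp] theorem rot_tail : rot (tail : LinkoidDart C) = tail := rfl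
@[simp] theorem rot_head : rot (head : LinkoidDart C) = head := rfl
@[simp] theorem rot_strand (c : C) (i : ZMod 4) : rot (strand c i) = strand c (i + 1) := rfl
@[simp] theorem rot_inv_head : rot⁻¹ (head : LinkoidDart C) = head := rfl

@[simp] theorem vertex_rot (d : LinkoidDart C) : vertex (rot d) = vertex d := by
  cases d <;> rfl

theorem vertex_surjective : Function.Surjective (vertex (C := C)) := by
  rintro (_ | _ | c)
  exacts [⟨tail, rfl⟩, ⟨head, rfl⟩, ⟨strand c 0, rfl⟩]

theorem facePerm_apply (arc : Equiv.Perm (LinkoidDart C)) (d : LinkoidDart C) :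
    facePerm arc d = rot⁻¹ (arc d) := rfl

@[simp] theorem rot_facePerm (arc : Equiv.Perm (LinkoidDart C)) (d : LinkoidDart C) :
    rot (facePerm arc d) = arc d := by simp [facePerm_apply]

theorem zmod_four_cases (i k : ZMod 4) : k = i ∨ k = i + 1 ∨ k = i + 2 ∨ k = i + 3 := by
  revert i k; decide

/-- A function which is invariant under `rot` is constant on the darts at a crossing. -/
theorem eq_of_comp_rot {M : Type*} {a : LinkoidDart C → M} (ha : ∀ d, a (rot d) = a d) (c : C)
    (i k : ZMod 4) : a (strand c k) = a (strand c i) := by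
  have h : ∀ i, a (strand c (i + 1)) = a (strand c i) := fun i => ha (strand c i)
  rcases zmod_four_cases i k with rfl | rfl | rfl | rfl
  · rfl
  · exact h i
  · rw [← h i, ← h (i + 1)]; ring_nf
  · rw [← h i, ← h (i + 1), ← h (i + 1 + 1)]; ring_nf

end LinkoidDart

namespace OneLinkoidDiagram

open LinkoidDart

variable {C : Type*} [Fintype C] (D : OneLinkoidDiagram C)

instance : Finite D.Region := Quotient.finite _

noncomputable instance : Fintype D.Region := Fintype.ofFinite _

theorem card_region : Fintype.card D.Region = Fintype.card C + 1 := by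
  have h := D.euler
  have : Nat.card (Quotient (Equiv.Perm.SameCycle.setoid (facePerm D.arc))) =
    Fintype.card D.Region := by
    rw [← Nat.card_eq_fintype_card]; rfl
  rw [this] at h
  push_cast at h
  omega

theorem leftRegion_surjective : Function.Surjective D.leftRegion := Quotient.mk_surjective

theorem leftRegion_eq_iff {d e : LinkoidDart C} :
    D.leftRegion d = D.leftRegion e ↔ (facePerm D.arc).SameCycle d e :=
  Quotient.eq (r := Equiv.Perm.SameCycle.setoid (facePerm D.arc))

@[simp] theorem leftRegion_facePerm (d : LinkoidDart C) :
    D.leftRegion (facePerm D.arc d) = D.leftRegion d := by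
  rw [leftRegion_eq_iff]
  exact (Equiv.Perm.SameCycle.refl _ _).apply_left

theorem leftRegion_rot_inv_arc (d : LinkoidDart C) :
    D.leftRegion (rot⁻¹ (D.arc d)) = D.leftRegion d := D.leftRegion_facePerm d

theorem leftRegion_arc_rot (d : LinkoidDart C) :
    D.leftRegion (D.arc (rot d)) = D.leftRegion d := by
  rw [← leftRegion_facePerm, facePerm_apply, D.arc_arc]; simp

/-- The darts on the left boundary of one region are obtained from one another by walking along
that boundary. -/
theorem exists_iterate_facePerm {d e : LinkoidDart C} (h : D.leftRegion d = D.leftRegion e) :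
    ∃ n : ℕ, (facePerm D.arc)^[n] d = e := by
  rw [leftRegion_eq_iff] at h
  obtain ⟨n, hn⟩ := h.exists_nat_pow_eq
  exact ⟨n, by rw [← hn, Equiv.Perm.coe_pow]⟩

/-- A property of darts which is preserved by `arc` and, in both directions, by `rot` holds for
all darts or for none: the diagram is connected. -/
theorem forall_of_connected {p : LinkoidDart C → Prop} (harc : ∀ d, p d → p (D.arc d))
    (hrot : ∀ d, p (rot d) ↔ p d) {d : LinkoidDart C} (hd : p d) (e : LinkoidDart C) : p e := by
  have h : ∀ x y, Relation.EqvGen (fun x y => y = D.arc x ∨ y = rot x) x y → (p x ↔ p y) := by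
    intro x y h
    induction h with
    | rel x y h =>
      rcases h with rfl | rfl
      · exact ⟨harc x, fun h => D.arc_arc x ▸ harc _ h⟩
      · exact (hrot x).symm
    | refl => exact Iff.rfl
    | symm _ _ _ ih => exact ih.symm
    | trans _ _ _ _ _ ih ih' => exact ih.trans ih'
  exact (h d e (D.connected d e)).1 hd

/-- The edges of the universe. -/
def Edge : Type _ := Quotient (Equiv.Perm.SameCycle.setoid D.arc)

/-- The edge of a dart. -/
def edge (d : LinkoidDart C) : D.Edge := Quotient.mk (Equiv.Perm.SameCycle.setoid D.arc) d

theorem edge_eq_iff {d e : LinkoidDart C} : D.edge d = D.edge e ↔ e = d ∨ e = D.arc d := by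
  have h2 : D.arc ^ 2 = 1 := by
    ext d; simp [sq, D.arc_arc]
  refine (Quotient.eq (r := Equiv.Perm.SameCycle.setoid D.arc)).trans ?_
  constructor
  · rintro ⟨n, hn⟩
    rcases Int.even_or_odd' n with ⟨k, rfl | rfl⟩
    · left
      rw [← hn, zpow_mul]
      norm_cast
      simp [h2]
    · right
      rw [← hn, zpow_add, zpow_mul]
      norm_cast
      simp [h2]
  · rintro (rfl | rfl)
    · exact .refl _ _
    · exact (Equiv.Perm.SameCycle.refl _ _).apply_right

@[simp] theorem edge_arc (d : LinkoidDart C) : D.edge (D.arc d) = D.edge d := by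
  rw [edge_eq_iff, D.arc_arc]; simp

instance : Finite D.Edge := Quotient.finite _

noncomputable instance : Fintype D.Edge := Fintype.ofFinite _

theorem card_edge : Fintype.card D.Edge = 2 * Fintype.card C + 1 := by
  classical
  have h := Finset.card_eq_sum_card_fiberwise (f := D.edge) (s := Finset.univ)
    (t := Finset.univ) (by simp)
  have h2 : ∀ e : D.Edge, (Finset.univ.filter fun d => D.edge d = e).card = 2 := by
    intro e
    obtain ⟨d, rfl⟩ : ∃ d, D.edge d = e := Quotient.mk_surjective e
    rw [Finset.card_eq_two]
    refine ⟨d, D.arc d, (D.arc_ne d).symm, ?_⟩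
    ext x
    simp [eq_comm (b := D.edge d), edge_eq_iff]
  simp only [h2, Finset.sum_const, Finset.card_univ, card_eq, smul_eq_mul] at h
  omega

/-! ### Potentials on the sphere -/

/-- Differences of a vertex potential and a region potential, as functions of corners: the corner
between `d` and `rot d` joins the vertex of `d` to the region on the left of `d`. -/
def cornerDiff : ((Option (Option C) → ℚ) × (D.Region → ℚ)) →ₗ[ℚ] (LinkoidDart C → ℚ) where
  toFun ab d := ab.1 (vertex d) - ab.2 (D.leftRegion d)
  map_add' x y := by ext; simp; ring
  map_smul' r x := by ext; simp; ring

/-- Differences of an edge potential across corners. -/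
def edgeDiff : (D.Edge → ℚ) →ₗ[ℚ] (LinkoidDart C → ℚ) where
  toFun h d := h (D.edge (rot d)) - h (D.edge d)
  map_add' x y := by ext; simp; ring
  map_smul' r x := by ext; simp; ring

theorem sum_rot_diff {a : LinkoidDart C → ℚ} (ha : ∀ d, a (rot d) = a d) (h : LinkoidDart C → ℚ) :
    ∑ d, a d * (h (rot d) - h d) = 0 := by
  simp only [mul_sub, Finset.sum_sub_distrib]
  rw [sub_eq_zero, ← Equiv.sum_comp rot (fun d => a d * h d)]
  simp only [ha]

theorem sum_face_diff {b : LinkoidDart C → ℚ} (hb : ∀ d, b (facePerm D.arc d) = b d)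
    {h : LinkoidDart C → ℚ} (hh : ∀ d, h (D.arc d) = h d) :
    ∑ d, b d * (h (rot d) - h d) = 0 := by
  simp only [mul_sub, Finset.sum_sub_distrib]
  rw [sub_eq_zero, ← Equiv.sum_comp (facePerm D.arc)]
  simp only [hb, rot_facePerm, hh]

theorem eq_const_of_comp_eq {h : LinkoidDart C → ℚ} (harc : ∀ d, h (D.arc d) = h d)
    (hrot : ∀ d, h (rot d) = h d) (d : LinkoidDart C) : h d = h tail :=
  D.forall_of_connected (p := fun d => h d = h tail) (fun d => by simp [harc])
    (fun d => by simp [hrot]) rfl d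

theorem finrank_ker_cornerDiff_le : Module.finrank ℚ (LinearMap.ker D.cornerDiff) ≤ 1 := by
  refine finrank_le_one ⟨(fun _ => 1, fun _ => 1), by ext; simp [cornerDiff]⟩ ?_
  rintro ⟨⟨a, b⟩, hab⟩
  have hab : ∀ d, a (vertex d) = b (D.leftRegion d) := fun d => by
    have := congrFun (LinearMap.mem_ker.1 hab) d
    simpa [cornerDiff, sub_eq_zero] using this
  have hc : ∀ d, a (vertex d) = a (vertex tail) := by
    refine D.eq_const_of_comp_eq (h := fun d => a (vertex d)) (fun d => ?_) (fun d => by simp)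
    rw [hab d, ← leftRegion_facePerm, ← hab, ← vertex_rot (facePerm _ _), rot_facePerm]
  refine ⟨a (vertex tail), Subtype.ext (Prod.ext ?_ ?_)⟩
  · funext v
    obtain ⟨d, rfl⟩ := vertex_surjective v
    simp [hc d]
  · funext r
    obtain ⟨d, rfl⟩ := D.leftRegion_surjective r
    simp [← hab, hc d]

theorem finrank_ker_edgeDiff_le : Module.finrank ℚ (LinearMap.ker D.edgeDiff) ≤ 1 := by
  refine finrank_le_one ⟨fun _ => 1, by ext; simp [edgeDiff]⟩ ?_
  rintro ⟨h, hh⟩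
  have hh : ∀ d, h (D.edge (rot d)) = h (D.edge d) := fun d => by
    have := congrFun (LinearMap.mem_ker.1 hh) d
    simpa [edgeDiff, sub_eq_zero] using this
  have hc := D.eq_const_of_comp_eq (h := fun d => h (D.edge d)) (fun d => by simp) hh
  refine ⟨h (D.edge tail), Subtype.ext ?_⟩
  funext e
  obtain ⟨d, rfl⟩ : ∃ d, D.edge d = e := Quotient.mk_surjective e
  simp [hc d]

/-- Orthogonality of the two kinds of differences. -/
theorem sum_cornerDiff_mul_edgeDiff (ab : (Option (Option C) → ℚ) × (D.Region → ℚ))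
    (h : D.Edge → ℚ) : ∑ d, D.cornerDiff ab d * D.edgeDiff h d = 0 := by
  have h1 := sum_rot_diff (a := fun d => ab.1 (vertex d)) (by simp) (fun d => h (D.edge d))
  have h2 := D.sum_face_diff (b := fun d => ab.2 (D.leftRegion d)) (by simp)
    (h := fun d => h (D.edge d)) (by simp)
  simp only [cornerDiff, edgeDiff, LinearMap.coe_mk, AddHom.coe_mk, sub_mul,
    Finset.sum_sub_distrib] at h1 h2 ⊢
  rw [h1, h2, sub_zero]

/-- On the sphere there is no harmonic part: Euler's formula makes the dimensions of the two
orthogonal spaces of differences add up to the number of corners. -/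
theorem exists_cornerDiff_add_edgeDiff (z : LinkoidDart C → ℚ) :
    ∃ ab h, z = D.cornerDiff ab + D.edgeDiff h := by
  have hdisj : Disjoint (LinearMap.range D.cornerDiff) (LinearMap.range D.edgeDiff) := by
    rw [Submodule.disjoint_def]
    rintro x ⟨ab, hab⟩ ⟨h, hh⟩
    have := D.sum_cornerDiff_mul_edgeDiff ab h
    rw [hab, hh] at this
    funext d
    have := (Finset.sum_eq_zero_iff_of_nonneg (fun d _ => mul_self_nonneg (x d))).1 this d
      (Finset.mem_univ d)
    simpa using this
  have htop : LinearMap.range D.cornerDiff ⊔ LinearMap.range D.edgeDiff = ⊤ := by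
    refine Submodule.eq_top_of_disjoint _ _ ?_ hdisj
    have h1 := LinearMap.finrank_range_add_finrank_ker D.cornerDiff
    have h2 := LinearMap.finrank_range_add_finrank_ker D.edgeDiff
    have h3 := D.finrank_ker_cornerDiff_le
    have h4 := D.finrank_ker_edgeDiff_le
    simp only [Module.finrank_prod, Module.finrank_fintype_fun_eq_card, card_edge, card_region,
      Fintype.card_option, card_eq] at h1 h2 ⊢
    omega
  obtain ⟨x, ⟨ab, rfl⟩, y, ⟨h, rfl⟩, hz⟩ := Submodule.mem_sup.1 (htop ▸ Submodule.mem_top (x := z))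
  exact ⟨ab, h, hz.symm⟩

/-- A function on corners with zero sum at every vertex and in every region is the difference of
an edge potential. -/
theorem exists_edge_potential {z : LinkoidDart C → ℚ}
    (hv : ∀ a : LinkoidDart C → ℚ, (∀ d, a (rot d) = a d) → ∑ d, a d * z d = 0)
    (hr : ∀ b : D.Region → ℚ, ∑ d, b (D.leftRegion d) * z d = 0) :
    ∃ h : LinkoidDart C → ℚ, (∀ d, h (D.arc d) = h d) ∧ h tail = 0 ∧
      ∀ d, h (rot d) = h d + z d := by
  obtain ⟨ab, h, rfl⟩ := D.exists_cornerDiff_add_edgeDiff z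
  have h1 : ∑ d, D.cornerDiff ab d * (D.cornerDiff ab + D.edgeDiff h) d = 0 := by
    have e1 := hv (fun d => ab.1 (vertex d)) (by simp)
    have e2 := hr ab.2
    conv_lhs => enter [2, d, 1]; rw [cornerDiff]
    simp only [LinearMap.coe_mk, AddHom.coe_mk, sub_mul, Finset.sum_sub_distrib]
    rw [e1, e2, sub_zero]
  have h2 : ∀ d, D.cornerDiff ab d = 0 := by
    simp only [Pi.add_apply, mul_add, Finset.sum_add_distrib, sum_cornerDiff_mul_edgeDiff,
      add_zero] at h1
    intro d
    have := (Finset.sum_eq_zero_iff_of_nonneg (fun d _ => mul_self_nonneg _)).1 h1 d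
      (Finset.mem_univ d)
    simpa using this
  refine ⟨fun d => h (D.edge d) - h (D.edge tail), by simp, by simp, fun d => ?_⟩
  simp [h2, edgeDiff]

/-- A function on corners which is orthogonal to all edge differences is the difference of a
potential on the vertices and one on the regions, normalised to vanish in the starred region. -/
theorem exists_corner_potential {z : LinkoidDart C → ℚ}
    (hz : ∀ h : LinkoidDart C → ℚ, (∀ d, h (D.arc d) = h d) → ∑ d, z d * (h (rot d) - h d) = 0) :
    ∃ (a : LinkoidDart C → ℚ) (b : D.Region → ℚ), (∀ d, a (rot d) = a d) ∧
      b D.starRegion = 0 ∧ ∀ d, a d = b (D.leftRegion d) + z d := by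
  obtain ⟨ab, h, rfl⟩ := D.exists_cornerDiff_add_edgeDiff z
  have h1 := hz (fun d => h (D.edge d)) (by simp)
  have h2 : ∀ d, D.edgeDiff h d = 0 := by
    have h1 : ∑ d, (D.cornerDiff ab + D.edgeDiff h) d * D.edgeDiff h d = 0 := h1
    simp only [Pi.add_apply, add_mul, Finset.sum_add_distrib, sum_cornerDiff_mul_edgeDiff,
      zero_add] at h1
    intro d
    have := (Finset.sum_eq_zero_iff_of_nonneg (fun d _ => mul_self_nonneg _)).1 h1 d
      (Finset.mem_univ d)
    simpa using this
  refine ⟨fun d => ab.1 (vertex d) - ab.2 D.starRegion, fun r => ab.2 r - ab.2 D.starRegion,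
    by simp, by simp, fun d => ?_⟩
  simp [h2, cornerDiff]

end OneLinkoidDiagram

/-! ### The Hall condition for crossings and regions -/

namespace LinkoidDart

variable {C : Type*} {P : Finset C}

/-- The ports of a set `P` of crossings: the darts at the crossings of `P`, the tail and the
head. -/
def IsPort (P : Finset C) : LinkoidDart C → Prop
  | tail => True
  | head => True
  | strand c _ => c ∈ P

@[simp] theorem isPort_tail : IsPort P tail := trivial

@[simp] theorem isPort_head : IsPort P head := trivial

@[simp] theorem isPort_strand {c : C} {i : ZMod 4} : IsPort P (strand c i) ↔ c ∈ P := Iff.rfl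

@[simp] theorem isPort_rot {d : LinkoidDart C} : IsPort P (rot d) ↔ IsPort P d := by
  cases d <;> rfl

end LinkoidDart

theorem even_card_of_involution {X : Type*} {s : Finset X} {g : X → X} (hmem : ∀ x ∈ s, g x ∈ s)
    (hne : ∀ x ∈ s, g x ≠ x) (hinv : ∀ x ∈ s, g (g x) = x) : Even s.card := by
  rw [even_iff_two_dvd, ← ZMod.natCast_eq_zero_iff]
  have := Finset.sum_involution (s := s) (f := fun _ => (1 : ZMod 2)) (fun x _ => g x)
    (fun _ _ => by decide) (fun x hx _ => hne x hx) hmem hinv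
  simpa using this

namespace OneLinkoidDiagram

open LinkoidDart

variable {C : Type*} [Fintype C] (D : OneLinkoidDiagram C)

open Classical in
/-- The regions with a corner at one of the crossings in `P`. -/
noncomputable def adjacentRegions (P : Finset C) : Finset D.Region :=
  Finset.univ.filter fun r => ∃ c ∈ P, ∃ i, D.cornerRegion c i = r

theorem mem_adjacentRegions {P : Finset C} {r : D.Region} :
    r ∈ D.adjacentRegions P ↔ ∃ c ∈ P, ∃ i, D.cornerRegion c i = r := by
  simp [adjacentRegions]

/-- Cut the universe open at the crossings of `P`: two darts belong to the same piece when they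
are connected by edges and through crossings outside `P`. -/
def pieceSetoid (P : Finset C) : Setoid (LinkoidDart C) :=
  Relation.EqvGen.setoid fun x y => y = D.arc x ∨ (y = rot x ∧ ¬ IsPort P x)

/-- The pieces into which the universe falls when it is cut open at the crossings of `P`. -/
def Piece (P : Finset C) : Type _ := Quotient (D.pieceSetoid P)

/-- The piece of a dart. -/
def piece (P : Finset C) (d : LinkoidDart C) : D.Piece P := Quotient.mk (D.pieceSetoid P) d

instance (P : Finset C) : Finite (D.Piece P) := Quotient.finite _

noncomputable instance (P : Finset C) : Fintype (D.Piece P) := Fintype.ofFinite _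

variable {P : Finset C}

theorem piece_surjective : Function.Surjective (D.piece P) := Quotient.mk_surjective

@[simp] theorem piece_arc (d : LinkoidDart C) : D.piece P (D.arc d) = D.piece P d :=
  (Quotient.sound (s := D.pieceSetoid P) (Relation.EqvGen.rel _ _ (.inl rfl))).symm

theorem piece_rot {d : LinkoidDart C} (h : ¬ IsPort P d) : D.piece P (rot d) = D.piece P d :=
  (Quotient.sound (s := D.pieceSetoid P) (Relation.EqvGen.rel _ _ (.inr ⟨rfl, h⟩))).symm

/-- A property of darts that is unchanged along edges and through crossings outside `P` depends
on the piece only. -/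
theorem eq_of_piece_eq {X : Type*} {g : LinkoidDart C → X} (harc : ∀ d, g (D.arc d) = g d)
    (hrot : ∀ d, ¬ IsPort P d → g (rot d) = g d) {d e : LinkoidDart C}
    (h : D.piece P d = D.piece P e) : g d = g e := by
  have h' : Relation.EqvGen _ d e := Quotient.exact h
  clear h
  induction h' with
  | rel x y h =>
    rcases h with rfl | ⟨rfl, h⟩
    · exact (harc _).symm
    · exact (hrot _ h).symm
  | refl => rfl
  | symm _ _ _ ih => exact ih.symm
  | trans _ _ _ _ _ ih ih' => exact ih.trans ih'

open Classical in
/-- The sums of a function on the corners at `P`, at the crossings of `P` and over the regions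
adjacent to them. -/
noncomputable def cornerSums (P : Finset C) :
    (P × ZMod 4 → ℚ) →ₗ[ℚ] (P → ℚ) × (D.adjacentRegions P → ℚ) where
  toFun w := (fun c => ∑ i, w (c, i),
    fun r => ∑ x : P × ZMod 4, if D.cornerRegion x.1 x.2 = r then w x else 0)
  map_add' x y := by
    ext <;> simp [← Finset.sum_add_distrib, ite_add_zero]
  map_smul' r x := by
    ext <;> simp [Finset.mul_sum]

/-- Differences at the corners of `P` of a function on pieces. -/
noncomputable def pieceDiff (P : Finset C) : (D.Piece P → ℚ) →ₗ[ℚ] (P × ZMod 4 → ℚ) where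
  toFun k x := k (D.piece P (strand x.1 (x.2 + 1))) - k (D.piece P (strand x.1 x.2))
  map_add' x y := by ext; simp; ring
  map_smul' r x := by ext; simp; ring

/-- A function at the corners of `P` without sums extends by zero to all corners, where it is the
difference of an edge potential; the potential cannot change away from `P`. -/
theorem ker_cornerSums_le : LinearMap.ker (D.cornerSums P) ≤ LinearMap.range (D.pieceDiff P) := by
  classical
  intro w hw
  rw [LinearMap.mem_ker, Prod.ext_iff] at hw
  obtain ⟨hw1, hw2⟩ := hw
  have hw1 : ∀ c : P, ∑ i, w (c, i) = 0 := fun c => congrFun hw1 c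
  have hw2 : ∀ r : D.adjacentRegions P,
      ∑ x : P × ZMod 4, (if D.cornerRegion x.1 x.2 = r then w x else 0) = 0 :=
    fun r => congrFun hw2 r
  let z : LinkoidDart C → ℚ
    | strand c i => if h : c ∈ P then w (⟨c, h⟩, i) else 0
    | _ => 0
  have hz : ∀ g : LinkoidDart C → ℚ,
      ∑ d, g d * z d = ∑ c : P, ∑ i, g (strand c i) * w (c, i) := by
    intro g
    rw [sum_eq]
    simp only [z, mul_zero, zero_add]
    rw [← Finset.sum_subset (Finset.subset_univ P), ← Finset.sum_coe_sort P]
    · simp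
    · intro c _ hc
      simp [hc]
  obtain ⟨h, harc, -, hrot⟩ := D.exists_edge_potential (z := z) (fun a ha => by
      rw [hz]
      refine Finset.sum_eq_zero fun c _ => ?_
      simp only [eq_of_comp_rot ha c.1 0]
      rw [← Finset.mul_sum, hw1, mul_zero])
    (fun b => by
      rw [hz fun d => b (D.leftRegion d), ← Fintype.sum_prod_type' (f := fun (c : P) i =>
        b (D.leftRegion (strand (c : C) i)) * w (c, i))]
      have : ∀ x : P × ZMod 4, b (D.leftRegion (strand x.1 x.2)) * w (x.1, x.2) =
          ∑ r : D.adjacentRegions P, b r * (if D.cornerRegion x.1 x.2 = r then w x else 0) := by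
        intro x
        rw [Finset.sum_eq_single ⟨D.cornerRegion x.1 x.2,
          D.mem_adjacentRegions.2 ⟨x.1, x.1.2, x.2, rfl⟩⟩]
        · simp [cornerRegion]
        · intro r _ hr
          rw [if_neg, mul_zero]
          exact fun h => hr (Subtype.ext h.symm)
        · simp
      simp only [this]
      rw [Finset.sum_comm]
      simp only [← Finset.mul_sum, hw2, mul_zero, Finset.sum_const_zero])
  refine ⟨Quotient.lift h fun d e hde => D.eq_of_piece_eq (P := P) harc (fun d hd => ?_)
    (Quotient.sound hde), ?_⟩
  · rw [hrot]
    cases d with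
    | strand c i => simp only [isPort_strand] at hd; simp [z, hd]
    | _ => simp [z]
  · funext x
    have := hrot (strand x.1 x.2)
    simp only [rot_strand, z, x.1.2, dite_true] at this
    change h _ - h _ = w x
    rw [this]
    simp

/-- By Euler's formula, many pieces arise when few regions are adjacent to the crossings of
`P`. -/
theorem le_card_adjacentRegions_add_card_piece (hP : P.Nonempty) :
    3 * P.card + 2 ≤ (D.adjacentRegions P).card + Fintype.card (D.Piece P) := by
  classical
  have h1 := LinearMap.finrank_range_add_finrank_ker (D.cornerSums P)
  have h2 := LinearMap.finrank_range_add_finrank_ker (D.pieceDiff P)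
  have h3 := Submodule.finrank_mono (D.ker_cornerSums_le (P := P))
  have h4 : Module.finrank ℚ (LinearMap.range (D.cornerSums P)) <
      Module.finrank ℚ ((P → ℚ) × (D.adjacentRegions P → ℚ)) := by
    -- Both families of sums have the same total.
    refine Submodule.finrank_lt fun htop => ?_
    obtain ⟨c, hc⟩ := hP
    obtain ⟨w, hw⟩ : (Pi.single ⟨c, hc⟩ 1, 0) ∈ LinearMap.range (D.cornerSums P) :=
      htop ▸ Submodule.mem_top
    have e1 : ∑ c, (D.cornerSums P w).1 c = ∑ x, w x := by
      simp [cornerSums, Fintype.sum_prod_type]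
    have e2 : ∑ r, (D.cornerSums P w).2 r = ∑ x, w x := by
      simp only [cornerSums, LinearMap.coe_mk, AddHom.coe_mk]
      rw [Finset.sum_comm]
      refine Finset.sum_congr rfl fun x _ => ?_
      rw [Finset.sum_eq_single ⟨D.cornerRegion x.1 x.2,
          D.mem_adjacentRegions.2 ⟨x.1, x.1.2, x.2, rfl⟩⟩]
      · simp
      · intro r _ hr
        rw [if_neg]
        exact fun h => hr (Subtype.ext h.symm)
      · simp
    rw [hw] at e1 e2
    simp at e1 e2
    exact one_ne_zero (e1.trans e2.symm)
  have h5 : 0 < Module.finrank ℚ (LinearMap.ker (D.pieceDiff P)) := by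
    refine Module.finrank_pos_iff_exists_ne_zero.2
      ⟨⟨fun _ => 1, by ext; simp [pieceDiff]⟩, fun h => ?_⟩
    have := congrFun (congrArg Subtype.val h) (D.piece P tail)
    simp at this
  simp only [Module.finrank_prod, Module.finrank_fintype_fun_eq_card, Fintype.card_prod,
    Fintype.card_coe, ZMod.card] at h1 h2 h4
  omega

open Classical in
/-- The ports in a piece. -/
noncomputable def ports (q : D.Piece P) : Finset (LinkoidDart C) :=
  Finset.univ.filter fun d => D.piece P d = q ∧ IsPort P d

theorem mem_ports {q : D.Piece P} {d : LinkoidDart C} :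
    d ∈ D.ports q ↔ D.piece P d = q ∧ IsPort P d := by
  simp [ports]

/-- A piece consists of whole edges, so it has an even number of darts, four of which belong to each
crossing outside `P`. -/
theorem even_card_ports (q : D.Piece P) : Even (D.ports q).card := by
  classical
  have h1 : Even (Finset.univ.filter fun d => D.piece P d = q).card :=
    even_card_of_involution (g := D.arc) (by simp) (fun d _ => D.arc_ne d)
      (fun d _ => D.arc_arc d)
  -- Away from the ports, turning by two quarters around a crossing is an involution.
  have h2 : Even (Finset.univ.filter fun d => D.piece P d = q ∧ ¬ IsPort P d).card := by
    refine even_card_of_involution (g := fun d => rot (rot d)) ?_ ?_ ?_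
    · intro d hd
      simp only [Finset.mem_filter, Finset.mem_univ, true_and, isPort_rot] at hd ⊢
      rw [piece_rot _ (by simpa using hd.2), piece_rot _ hd.2]
      exact hd
    · rintro (_ | _ | ⟨c, i⟩) hd
      · simp at hd
      · simp at hd
      · simp only [rot_strand, ne_eq, strand.injEq, true_and]
        clear hd
        revert i; decide
    · rintro (_ | _ | ⟨c, i⟩) hd
      · rfl
      · rfl
      · simp only [rot_strand, strand.injEq, true_and]
        clear hd
        revert i; decide
  have h3 : (Finset.univ.filter fun d => D.piece P d = q).card =
      (D.ports q).card + (Finset.univ.filter fun d => D.piece P d = q ∧ ¬ IsPort P d).card := by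
    rw [ports, ← Finset.filter_filter, ← Finset.filter_filter,
      Finset.card_filter_add_card_filter_not]
  rw [h3, Nat.even_add] at h1
  exact h1.2 h2

theorem ports_nonempty (q : D.Piece P) : (D.ports q).Nonempty := by
  by_contra h
  obtain ⟨d, rfl⟩ := D.piece_surjective q
  have hno : ∀ e, D.piece P e = D.piece P d → ¬ IsPort P e := fun e he hp =>
    h ⟨e, D.mem_ports.2 ⟨he, hp⟩⟩
  refine hno tail ?_ trivial
  -- A piece without ports could not be left, but the diagram is connected.
  have key : ∀ e, D.piece P e = D.piece P d → D.piece P (rot e) = D.piece P d :=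
    fun e he => (D.piece_rot (hno e he)).trans he
  refine D.forall_of_connected (p := fun e => D.piece P e = D.piece P d) (by simp)
    (fun e => ⟨fun he => ?_, key e⟩) rfl tail
  rw [← he, piece_rot _ (isPort_rot.not.1 (hno _ he))]

theorem two_le_card_ports (q : D.Piece P) : 2 ≤ (D.ports q).card := by
  obtain ⟨k, hk⟩ := D.even_card_ports q
  have := (D.ports_nonempty q).card_pos
  omega

theorem sum_card_ports : ∑ q : D.Piece P, (D.ports q).card = 4 * P.card + 2 := by
  classical
  have h := Finset.card_eq_sum_card_fiberwise (f := D.piece P)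
    (s := Finset.univ.filter (IsPort P)) (t := Finset.univ) (by simp)
  have h' : ∑ q : D.Piece P, (D.ports q).card = (Finset.univ.filter (IsPort P)).card := by
    rw [h]
    refine Finset.sum_congr rfl fun q _ => congrArg _ ?_
    ext d
    simp [mem_ports, and_comm]
  rw [h', Finset.card_filter, sum_eq]
  simp only [isPort_tail, isPort_head, isPort_strand, if_true, Finset.sum_const,
    Finset.card_univ, ZMod.card, smul_eq_mul]
  rw [← Finset.mul_sum]
  simp
  ring

/-- The Hall condition for crossings and regions, with one region to spare. -/
theorem card_lt_card_adjacentRegions (hP : P.Nonempty) :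
    P.card + 1 ≤ (D.adjacentRegions P).card := by
  have h1 := D.le_card_adjacentRegions_add_card_piece hP
  have h2 := D.sum_card_ports (P := P)
  have h3 : ∑ q : D.Piece P, 2 ≤ ∑ q : D.Piece P, (D.ports q).card :=
    Finset.sum_le_sum fun q _ => D.two_le_card_ports q
  simp only [Finset.sum_const, Finset.card_univ, smul_eq_mul] at h3
  omega

/-- When the Hall condition is sharp for `P`, each piece has just two ports, so that it takes the
place of an edge between crossings of `P`, the tail and the head. -/
theorem card_ports_eq_two (hP : P.Nonempty) (h : (D.adjacentRegions P).card ≤ P.card + 1)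
    (q : D.Piece P) : (D.ports q).card = 2 := by
  have h1 := D.le_card_adjacentRegions_add_card_piece hP
  have h2 := D.sum_card_ports (P := P)
  have h3 : ∑ q : D.Piece P, 2 = ∑ q : D.Piece P, (D.ports q).card := by
    have h3 : ∑ q : D.Piece P, 2 ≤ ∑ q : D.Piece P, (D.ports q).card :=
      Finset.sum_le_sum fun q _ => D.two_le_card_ports q
    simp only [Finset.sum_const, Finset.card_univ, smul_eq_mul] at h3 ⊢
    omega
  exact ((Finset.sum_eq_sum_iff_of_le fun q _ => D.two_le_card_ports q).1 h3 q
    (Finset.mem_univ q)).symm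

end OneLinkoidDiagram

namespace OneLinkoidDiagram

open LinkoidDart

variable {C : Type*} [Fintype C] {D : OneLinkoidDiagram C}

/-! ### Clock states and forward closed sets of edges -/

namespace ClockState

/-- The dart on the clockwise side of the marker at `c`, across which a clockwise rotation moves
the marker. -/
def dart (s : D.ClockState) (c : C) : LinkoidDart C := strand c (s.marker c)

variable (s : D.ClockState)

@[simp] theorem leftRegion_dart (c : C) : D.leftRegion (s.dart c) = s.regionAt c := rfl

theorem regionAt_injective : Function.Injective s.regionAt :=
  fun c d h => s.bijOn.injOn (Set.mem_univ c) (Set.mem_univ d) h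

theorem regionAt_ne_star (c : C) : s.regionAt c ≠ D.starRegion := s.bijOn.mapsTo (Set.mem_univ c)

theorem exists_regionAt_eq {r : D.Region} (hr : r ≠ D.starRegion) : ∃ c, s.regionAt c = r := by
  obtain ⟨c, -, hc⟩ := s.bijOn.surjOn hr
  exact ⟨c, hc⟩

/-- There is no marker in the corner between `d` and `rot d`. At the tail and the head, where that
corner is not at a crossing, this holds trivially. -/
def IsFree (d : LinkoidDart C) : Prop := ∀ c, d ≠ s.dart c

theorem isFree_strand {c : C} {i : ZMod 4} : s.IsFree (strand c i) ↔ i ≠ s.marker c := by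
  simp only [IsFree, dart, ne_eq, strand.injEq, not_and]
  exact ⟨fun h => h c rfl, fun h d hd => by subst hd; exact h⟩

/-- A set of edges (given by their darts) which contains with an edge the next one
counterclockwise at each of its ends, unless the marker lies in between. -/
structure IsForwardClosed (A : Set (LinkoidDart C)) : Prop where
  arc_mem : ∀ {d}, d ∈ A → D.arc d ∈ A
  rot_mem : ∀ {d}, d ∈ A → s.IsFree d → rot d ∈ A

variable {s} {A : Set (LinkoidDart C)}

theorem IsForwardClosed.succ_mem (hA : s.IsForwardClosed A) {c : C} {i : ZMod 4}
    (h : strand c i ∈ A) (hi : i ≠ s.marker c) : strand c (i + 1) ∈ A :=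
  hA.rot_mem h (s.isFree_strand.2 hi)

/-- A forward closed set that meets a crossing contains the last dart there, before the marker. -/
theorem IsForwardClosed.dart_mem (hA : s.IsForwardClosed A) {c : C} {i : ZMod 4}
    (h : strand c i ∈ A) : s.dart c ∈ A := by
  have hs : ∀ {i}, strand c i ∈ A → strand c (i + 1) ∈ A ∨ s.dart c ∈ A := by
    intro i hi
    by_cases h' : i = s.marker c
    · right; rw [dart, ← h']; exact hi
    · exact .inl (hA.succ_mem hi h')
  by_contra hd
  have h1 := (hs h).resolve_right hd
  have h2 := (hs h1).resolve_right hd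
  have h3 := (hs h2).resolve_right hd
  apply hd
  rcases zmod_four_cases i (s.marker c) with hm | hm | hm | hm <;> rw [dart, hm]
  · exact h
  · exact h1
  · convert h2 using 2; ring
  · convert h3 using 2; ring

/-! ### Sets of edges without holes -/

variable (D) in
/-- The darts which are connected to the tail by edges and corners that avoid `A`. -/
def outside (A : Set (LinkoidDart C)) : Set (LinkoidDart C) :=
  {d | Relation.ReflTransGen
    (fun x y => (y = D.arc x ∨ y = rot x ∨ x = rot y) ∧ y ∉ A) tail d}

theorem not_mem_of_mem_outside (htail : tail ∉ A) {d : LinkoidDart C} (hd : d ∈ outside D A) :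
    d ∉ A := by
  rcases Relation.ReflTransGen.cases_tail hd with rfl | ⟨_, _, h⟩
  · exact htail
  · exact h.2

theorem mem_outside_of_adj {d e : LinkoidDart C} (hd : d ∈ outside D A)
    (h : e = D.arc d ∨ e = rot d ∨ d = rot e) (he : e ∉ A) : e ∈ outside D A :=
  Relation.ReflTransGen.tail hd ⟨h, he⟩

theorem outside_anti {B : Set (LinkoidDart C)} (h : A ⊆ B) : outside D B ⊆ outside D A :=
  fun _ hd => Relation.ReflTransGen.mono (fun _ _ hxy => ⟨hxy.1, fun hy => hxy.2 (h hy)⟩) _ _ hd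

/-- Filling in what is not connected to the tail leaves a set without further holes. -/
theorem outside_subset_outside_compl : outside D A ⊆ outside D (outside D A)ᶜ := by
  intro d hd
  induction hd with
  | refl => exact .refl
  | tail hx h ih => exact mem_outside_of_adj ih h.1 fun hn => hn (mem_outside_of_adj hx h.1 h.2)

theorem subset_compl_outside (htail : tail ∉ A) : A ⊆ (outside D A)ᶜ :=
  fun _ hd ho => not_mem_of_mem_outside htail ho hd

/-- Filling the holes of a forward closed set. -/
theorem IsForwardClosed.compl_outside (hA : s.IsForwardClosed A) (htail : tail ∉ A) :
    s.IsForwardClosed (outside D A)ᶜ where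
  arc_mem {d} hd ho := by
    by_cases h : d ∈ A
    · exact not_mem_of_mem_outside htail ho (hA.arc_mem h)
    · exact hd (mem_outside_of_adj ho (.inl (D.arc_arc d).symm) h)
  rot_mem {d} hd hf ho := by
    by_cases h : d ∈ A
    · exact not_mem_of_mem_outside htail ho (hA.rot_mem h hf)
    · exact hd (mem_outside_of_adj ho (.inr (.inr rfl)) h)

/-! ### Directed walks and their winding potentials -/

/-- One step of a directed walk: to the other end of the same edge, or across a corner without
marker to the next edge counterclockwise. -/
def ForwardStep (s : D.ClockState) (x y : LinkoidDart C) : Prop :=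
  y = D.arc x ∨ (y = rot x ∧ s.IsFree x)

theorem isForwardClosed_reachable (x : LinkoidDart C) :
    s.IsForwardClosed {y | Relation.ReflTransGen s.ForwardStep x y} where
  arc_mem h := .tail h (.inl rfl)
  rot_mem h hf := .tail h (.inr ⟨rfl, hf⟩)

theorem IsForwardClosed.mem_of_reachable (hA : s.IsForwardClosed A) {x y : LinkoidDart C}
    (hx : x ∈ A) (h : Relation.ReflTransGen s.ForwardStep x y) : y ∈ A := by
  induction h with
  | refl => exact hx
  | tail _ h ih =>
    rcases h with rfl | ⟨rfl, h⟩
    · exact hA.arc_mem ih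
    · exact hA.rot_mem ih h

/-- The corners crossed by a directed walk, counted with multiplicity. -/
theorem IsForwardClosed.exists_crossings (hA : s.IsForwardClosed A) {x y : LinkoidDart C}
    (hx : x ∈ A) (h : Relation.ReflTransGen s.ForwardStep x y) :
    ∃ z : LinkoidDart C → ℚ, (∀ d, 0 ≤ z d) ∧ (∀ d, z d ≠ 0 → s.IsFree d ∧ d ∈ A ∧ rot d ∈ A) ∧
      ∀ g : LinkoidDart C → ℚ, (∀ d, g (D.arc d) = g d) →
        ∑ d, z d * (g (rot d) - g d) = g y - g x := by
  classical
  induction h with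
  | refl => exact ⟨0, by simp, by simp, by simp⟩
  | @tail u v hu h ih =>
    obtain ⟨z, h0, hz, hsum⟩ := ih
    rcases h with rfl | ⟨rfl, h⟩
    · exact ⟨z, h0, hz, fun g hg => by rw [hsum g hg, hg]⟩
    · have huA := hA.mem_of_reachable hx hu
      refine ⟨z + Pi.single u 1, fun d => ?_, fun d hd => ?_, fun g hg => ?_⟩
      · have : 0 ≤ (Pi.single u 1 : LinkoidDart C → ℚ) d := by
          rw [Pi.single_apply]; split_ifs <;> simp
        exact add_nonneg (h0 d) this
      · by_cases hdu : d = u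
        · subst hdu
          exact ⟨h, huA, hA.rot_mem huA h⟩
        · exact hz d (by simpa [hdu] using hd)
      · simp only [Pi.add_apply, add_mul, Finset.sum_add_distrib, hsum g hg]
        rw [Finset.sum_eq_single u (by intro d _ hd; simp [hd]) (by simp)]
        simp

/-- Directed closed walks turn counterclockwise: the winding numbers around regions (normalised
at the starred region) are nonnegative. Otherwise the crossings with negative winding number
would violate the Hall condition. -/
theorem winding_nonneg (s : D.ClockState) {z a : LinkoidDart C → ℚ} {b : D.Region → ℚ}
    (hz : ∀ d, 0 ≤ z d) (hfree : ∀ c, z (s.dart c) = 0) (ha : ∀ d, a (rot d) = a d)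
    (hstar : b D.starRegion = 0) (hab : ∀ d, a d = b (D.leftRegion d) + z d) (r : D.Region) :
    0 ≤ b r := by
  classical
  by_contra hr
  rw [not_le] at hr
  let P : Finset C := Finset.univ.filter fun c => a (s.dart c) < 0
  have hmark : ∀ r, b r < 0 → ∃ c ∈ P, s.regionAt c = r := by
    intro r hr
    obtain ⟨c, rfl⟩ := s.exists_regionAt_eq (r := r) (by rintro rfl; exact hr.ne hstar)
    refine ⟨c, ?_, rfl⟩
    simpa [P, hab, hfree] using hr
  obtain ⟨c, hc, -⟩ := hmark r hr
  have hsub : D.adjacentRegions P ⊆ P.image s.regionAt := by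
    intro r hr
    obtain ⟨c, hc, i, rfl⟩ := D.mem_adjacentRegions.1 hr
    obtain ⟨c', hc', h⟩ := hmark (D.cornerRegion c i) (by
      have h1 := hab (strand c i)
      have h2 : a (s.dart c) < 0 := by simpa [P] using hc
      rw [dart, eq_of_comp_rot ha c i] at h2
      have := hz (strand c i)
      rw [cornerRegion]
      linarith)
    exact Finset.mem_image.2 ⟨c', hc', h⟩
  have := D.card_lt_card_adjacentRegions ⟨c, hc⟩
  have := (Finset.card_le_card hsub).trans Finset.card_image_le
  omega

/-- No directed closed walk in a set without holes passes the corner between two of its edges at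
a crossing whose other side is outside the set: such a walk winds around the crossing, but not
around the outside. -/
theorem IsForwardClosed.not_reachable (hA : s.IsForwardClosed A) (htail : tail ∉ A)
    (hfill : ∀ d, d ∉ A → d ∈ outside D A) {c : C} (hc : s.dart c ∈ A)
    (hout : strand c (s.marker c + 1) ∉ A) :
    ¬ Relation.ReflTransGen s.ForwardStep (s.dart c) (strand c (s.marker c - 1)) := by
  classical
  intro h
  set y := strand c (s.marker c - 1) with hy
  obtain ⟨z₀, h0, hz₀, hsum₀⟩ := hA.exists_crossings hc h
  have hyA := hA.mem_of_reachable hc h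
  have hyr : rot y = s.dart c := by simp [hy, dart]
  have hyf : s.IsFree y := s.isFree_strand.2 (by simp only [ne_eq, sub_eq_self]; decide)
  let z : LinkoidDart C → ℚ := fun d => z₀ d + if d = y then 1 else 0
  have hz0 : ∀ d, 0 ≤ z d := fun d => add_nonneg (h0 d) (by split_ifs <;> simp)
  have hz : ∀ d, z d ≠ 0 → s.IsFree d ∧ d ∈ A ∧ rot d ∈ A := by
    intro d hd
    by_cases hdy : d = y
    · subst hdy; exact ⟨hyf, hyA, hyr ▸ hc⟩
    · exact hz₀ d (by simpa [z, hdy] using hd)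
  obtain ⟨a, b, ha, hstar, hab⟩ := D.exists_corner_potential (z := z) fun g hg => by
    simp only [z, add_mul, Finset.sum_add_distrib, hsum₀ g hg]
    simp [hyr]
  have hb := s.winding_nonneg hz0 (fun c => by
    by_contra hne; exact (hz _ hne).1 c rfl) ha hstar hab
  have hzout : ∀ d, d ∉ A → z d = 0 := fun d hd => by
    by_contra hne; exact hd (hz d hne).2.1
  have hzout' : ∀ d, rot d ∉ A → z d = 0 := fun d hd => by
    by_contra hne; exact hd (hz d hne).2.2
  have hconst : ∀ d ∈ outside D A, a d = 0 := by
    intro d hd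
    induction hd with
    | refl => rw [hab, hzout _ htail]; simpa [starRegion] using hstar
    | @tail u v hu h ih =>
      rcases h with ⟨rfl | rfl | rfl, hv⟩
      · have huA : u ∉ A := not_mem_of_mem_outside htail hu
        have h1 := hab u
        have h2 := hab (rot⁻¹ (D.arc u))
        rw [hzout u huA] at h1
        rw [leftRegion_rot_inv_arc, hzout' (rot⁻¹ (D.arc u)) (by simpa using hv), ← ha] at h2
        rw [show rot (rot⁻¹ (D.arc u)) = D.arc u from rot.apply_symm_apply _] at h2
        linarith
      · rw [ha, ih]
      · rw [← ha, ih]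
  have h1 : a y = 0 := by
    rw [hy, eq_of_comp_rot ha c (s.marker c + 1)]
    exact hconst _ (hfill _ hout)
  have h2 := hab y
  have h3 := hb (D.leftRegion y)
  have h4 := h0 y
  simp only [z, if_true] at h2
  linarith

/-- A smallest forward closed set without holes meets each crossing in all four darts or at most in
the one on the clockwise side of the marker. Otherwise the part that is reached from that one dart
would, after its holes are filled, be a smaller such set. -/
theorem exists_forwardClosed_all_or_dart (hA : s.IsForwardClosed A) (htail : tail ∉ A)
    (hne : A.Nonempty) :
    ∃ B : Set (LinkoidDart C), s.IsForwardClosed B ∧ tail ∉ B ∧ B.Nonempty ∧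
      ∀ c k, strand c k ∈ B → k ≠ s.marker c → ∀ j, strand c j ∈ B := by
  let F : Set (Set (LinkoidDart C)) := {B | s.IsForwardClosed B ∧ tail ∉ B ∧ B.Nonempty ∧
    ∀ d, d ∉ B → d ∈ outside D B}
  have hfill : ∀ B, s.IsForwardClosed B → tail ∉ B → B.Nonempty → (outside D B)ᶜ ∈ F :=
    fun B hB ht hn => ⟨hB.compl_outside ht, fun h => h .refl,
      hn.mono (subset_compl_outside ht), fun d hd =>
        outside_subset_outside_compl (not_not.1 hd)⟩
  obtain ⟨B, ⟨hB, ht, hn, hBfill⟩, hmin⟩ :=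
    (wellFounded_lt (α := Set (LinkoidDart C))).has_min F ⟨_, hfill A hA htail hne⟩
  refine ⟨B, hB, ht, hn, fun c k hk hkm => ?_⟩
  by_contra hall
  have hs : ∀ i, strand c i ∈ B → i ≠ s.marker c → strand c (i + 1) ∈ B :=
    fun i hi h => hB.succ_mem hi h
  set m := s.marker c with hm
  have e1 : m + 2 ≠ m := by rw [ne_eq, add_eq_left]; decide
  have e2 : m + 1 ≠ m := by rw [ne_eq, add_eq_left]; decide
  have e3 : m + 3 ≠ m := by rw [ne_eq, add_eq_left]; decide
  have e4 : m + 2 + 1 = m + 3 := by ring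
  have e5 : m + 1 + 1 = m + 2 := by ring
  have e6 : m + 3 = m - 1 := by rw [eq_sub_iff_add_eq, add_assoc, add_eq_left]; decide
  have e7 : m + 3 + 1 = m := by rw [e6, sub_add_cancel]
  have hdart : s.dart c ∈ B := hB.dart_mem hk
  have hout : strand c (m + 1) ∉ B := by
    intro h1
    have h2 := e5 ▸ hs _ h1 e2
    have h3 := e4 ▸ hs _ h2 e1
    apply hall
    intro j
    rcases zmod_four_cases m j with rfl | rfl | rfl | rfl
    exacts [hdart, h1, h2, h3]
  have hprev : strand c (m + 3) ∈ B := by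
    rcases zmod_four_cases m k with rfl | rfl | rfl | rfl
    exacts [absurd rfl hkm, absurd hk hout, e4 ▸ hs _ hk e1, hk]
  -- The part of the set that is reached from the dart of the marker is smaller.
  let R : Set (LinkoidDart C) := {y | Relation.ReflTransGen s.ForwardStep (s.dart c) y}
  have hR : s.IsForwardClosed R := isForwardClosed_reachable _
  have hRB : R ⊆ B := fun y hy => hB.mem_of_reachable hdart hy
  have hRprev : strand c (m + 3) ∉ R := by
    rw [e6]
    exact hB.not_reachable ht hBfill hdart hout
  have hRout : strand c (m + 2) ∉ R := fun h => hRprev (e4 ▸ hR.succ_mem h e1)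
  have h1 : strand c (m + 1) ∈ outside D R := outside_anti hRB (hBfill _ hout)
  have h2 : strand c (m + 2) ∈ outside D R :=
    mem_outside_of_adj h1 (.inr (.inl (by rw [rot_strand, e5]))) hRout
  have h3 : strand c (m + 3) ∈ outside D R :=
    mem_outside_of_adj h2 (.inr (.inl (by rw [rot_strand, e4]))) hRprev
  refine hmin _ (hfill R hR (fun h => ht (hRB h)) ⟨_, .refl⟩) ?_
  refine lt_of_le_of_ne (fun d hd => ?_) ?_
  · by_contra hdB
    exact hd (outside_anti hRB (hBfill d hdB))
  · intro h
    exact (h ▸ hprev : strand c (m + 3) ∈ (outside D R)ᶜ) h3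

end ClockState

/-! ### Rotatable markers from forward closed sets -/

variable (D) in
/-- Around a piece, the regions on both sides of its ports balance. -/
theorem sum_ports_leftRegion {P : Finset C} (q : D.Piece P) (b : D.Region → ℕ) :
    ∑ d ∈ D.ports q, b (D.leftRegion (rot⁻¹ d)) = ∑ d ∈ D.ports q, b (D.leftRegion d) := by
  classical
  have h1 : ∑ d with D.piece P d = q, b (D.leftRegion (rot⁻¹ d)) =
      ∑ d with D.piece P d = q, b (D.leftRegion d) := by
    symm
    refine Finset.sum_equiv D.arc (by simp) fun d _ => ?_
    rw [leftRegion_rot_inv_arc]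
  have h2 : ∑ d with D.piece P d = q ∧ ¬ IsPort P d, b (D.leftRegion (rot⁻¹ d)) =
      ∑ d with D.piece P d = q ∧ ¬ IsPort P d, b (D.leftRegion d) := by
    symm
    refine Finset.sum_equiv rot (fun d => ?_) fun d _ => by simp
    simp only [Finset.mem_filter, Finset.mem_univ, true_and, isPort_rot]
    refine and_congr_left fun h => ?_
    rw [piece_rot _ h]
  rw [← Finset.sum_filter_add_sum_filter_not _ (IsPort P),
    ← Finset.sum_filter_add_sum_filter_not (Finset.univ.filter fun d => D.piece P d = q)
      (IsPort P) (fun d => b (D.leftRegion d)), Finset.filter_filter, Finset.filter_filter, h2,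
    add_left_inj] at h1
  rw [ports]
  convert h1

namespace ClockState

variable {s : D.ClockState} {A : Set (LinkoidDart C)}

open Classical in
/-- The Hall condition is sharp for the crossings which are not entirely surrounded by a set as in
`exists_forwardClosed_all_or_dart`. -/
theorem card_adjacentRegions_le (hA : s.IsForwardClosed A)
    (hfull : ∀ c k, strand c k ∈ A → k ≠ s.marker c → ∀ j, strand c j ∈ A) :
    (D.adjacentRegions (Finset.univ.filter fun c => ¬ ∀ j, strand c j ∈ A)).card ≤
      (Finset.univ.filter fun c => ¬ ∀ j, strand c j ∈ A).card + 1 := by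
  set P : Finset C := Finset.univ.filter fun c => ¬ ∀ j, strand c j ∈ A with hP
  have hmemP : ∀ c, c ∈ P ↔ ¬ ∀ j, strand c j ∈ A := by simp [hP]
  have hmark : ∀ c ∈ P, ∀ k, strand c k ∈ A → k = s.marker c := by
    intro c hc k hk
    by_contra hne
    exact (hmemP c).1 hc (hfull c k hk hne)
  -- Each crossing of `P` accounts for the region of its marker, or for the region which its
  -- marker is about to enter.
  let ψ : C → D.Region := fun c =>
    if s.dart c ∈ A then D.cornerRegion c (s.marker c - 1) else s.regionAt c
  have hsub : D.adjacentRegions P ⊆ insert D.starRegion (P.image ψ) := by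
    intro r hr
    obtain ⟨c, hc, k, hck⟩ := D.mem_adjacentRegions.1 hr
    by_cases hstar : r = D.starRegion
    · exact Finset.mem_insert.2 (.inl hstar)
    refine Finset.mem_insert_of_mem (Finset.mem_image.2 ?_)
    obtain ⟨x, hx⟩ := s.exists_regionAt_eq hstar
    by_cases hxA : s.dart x ∈ A
    · obtain ⟨e, heA, her⟩ : ∃ e, e ∉ A ∧ D.leftRegion e = r := by
        by_cases h : strand c k ∈ A
        · have h' : strand c (k + 1) ∉ A := by
            intro h'
            have e1 := hmark c hc _ h
            have e2 := hmark c hc _ h'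
            rw [← e1, add_eq_left] at e2
            exact absurd e2 (by decide)
          refine ⟨D.arc (strand c (k + 1)), fun h2 => h' ?_, ?_⟩
          · simpa [D.arc_arc] using hA.arc_mem h2
          · rw [← rot_strand, leftRegion_arc_rot]
            exact hck
        · exact ⟨_, h, hck⟩
      -- Somewhere along the boundary of the region one leaves the set.
      obtain ⟨n, hn⟩ := D.exists_iterate_facePerm (d := s.dart x) (e := e) (by
        rw [leftRegion_dart, hx, her])
      obtain ⟨y, hyA, hyA', hyr⟩ : ∃ y, y ∈ A ∧ facePerm D.arc y ∉ A ∧ D.leftRegion y = r := by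
        clear her
        induction n generalizing e with
        | zero => exact absurd hxA (by rw [← hn] at heA; exact heA)
        | succ n ih =>
          by_cases h : (facePerm D.arc)^[n] (s.dart x) ∈ A
          · refine ⟨_, h, ?_, ?_⟩
            · rwa [← Function.iterate_succ_apply' (facePerm D.arc), hn]
            · clear ih hn h
              induction n with
              | zero => exact hx
              | succ n ih => rw [Function.iterate_succ_apply', leftRegion_facePerm, ih]
          · exact ih _ h rfl
      have hw : rot (facePerm D.arc y) ∈ A := by rw [rot_facePerm]; exact hA.arc_mem hyA
      have hwr : D.leftRegion (facePerm D.arc y) = r := by rw [leftRegion_facePerm, hyr]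
      generalize facePerm D.arc y = w at *
      cases w with
      | tail => exact absurd hw hyA'
      | head => exact absurd hw hyA'
      | strand c' i =>
        have hc' : c' ∈ P := (hmemP c').2 fun h => hyA' (h i)
        rw [rot_strand] at hw
        have hi := hmark c' hc' _ hw
        refine ⟨c', hc', ?_⟩
        simp only [ψ]
        rw [if_pos (hA.dart_mem hw), ← hi, add_sub_cancel_right]
        exact hwr
    · refine ⟨x, (hmemP x).2 fun h => hxA (h _), ?_⟩
      simp only [ψ, if_neg hxA, hx]
  calc _ ≤ (insert D.starRegion (P.image ψ)).card := Finset.card_le_card hsub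
    _ ≤ (P.image ψ).card + 1 := Finset.card_insert_le _ _
    _ ≤ P.card + 1 := by gcongr; exact Finset.card_image_le

/-- A forward closed set of edges that avoids the tail yields one or two markers which can be
rotated clockwise: the ports of a piece of the set, of which there are two at most.
Here `c = d` means that one marker turns and stays in its region. -/
theorem exists_rotatable (hA : s.IsForwardClosed A) (htail : tail ∉ A) (hne : A.Nonempty) :
    ∃ c d, D.cornerRegion c (s.marker c - 1) = s.regionAt d ∧
      D.cornerRegion d (s.marker d - 1) = s.regionAt c := by
  classical
  obtain ⟨B, hB, ht, ⟨d₀, hd₀⟩, hfull⟩ := exists_forwardClosed_all_or_dart hA htail hne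
  have hcard := card_adjacentRegions_le hB hfull
  set P : Finset C := Finset.univ.filter fun c => ¬ ∀ j, strand c j ∈ B with hP
  have hmemP : ∀ c, c ∉ P ↔ ∀ j, strand c j ∈ B := by simp [hP]
  have hPne : P.Nonempty := by
    by_contra hempty
    refine ht (D.forall_of_connected (p := fun d => d ∈ B) (fun d => hB.arc_mem) (fun d => ?_)
      hd₀ tail)
    cases d with
    | tail => rfl
    | head => rfl
    | strand c i =>
      have := (hmemP c).1 (by simp [Finset.not_nonempty_iff_eq_empty.1 hempty])
      exact ⟨fun _ => this _, fun _ => this _⟩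
  have hmem : ∀ d, D.piece P d = D.piece P d₀ → d ∈ B := by
    intro d hd
    refine (D.eq_of_piece_eq (g := fun d => d ∈ B) (fun d => ?_) (fun d hd => ?_) hd).mpr hd₀
    · exact propext ⟨fun h => by simpa [D.arc_arc] using hB.arc_mem h, hB.arc_mem⟩
    · cases d with
      | tail => exact absurd trivial hd
      | head => exact absurd trivial hd
      | strand c i =>
        have := (hmemP c).1 hd
        exact propext ⟨fun _ => this _, fun _ => this _⟩
  have hport : ∀ d ∈ D.ports (D.piece P d₀), d = head ∨ ∃ c, d = s.dart c := by
    intro d hd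
    obtain ⟨hd, hp⟩ := D.mem_ports.1 hd
    have hdB := hmem d hd
    cases d with
    | tail => exact absurd hdB ht
    | head => exact .inl rfl
    | strand c i =>
      refine .inr ⟨c, ?_⟩
      by_cases hi : i = s.marker c
      · rw [hi]; rfl
      · exact absurd hp ((hmemP c).2 (hfull c i hdB hi))
  obtain ⟨x, y, hxy, hports⟩ := Finset.card_eq_two.1 (D.card_ports_eq_two hPne hcard
    (D.piece P d₀))
  have hsum : ∀ b : D.Region → ℕ, b (D.leftRegion (rot⁻¹ x)) + b (D.leftRegion (rot⁻¹ y)) =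
      b (D.leftRegion x) + b (D.leftRegion y) := by
    intro b
    have := D.sum_ports_leftRegion (D.piece P d₀) b
    rwa [hports, Finset.sum_pair hxy, Finset.sum_pair hxy] at this
  have hprev : ∀ c, D.leftRegion (rot⁻¹ (s.dart c)) = D.cornerRegion c (s.marker c - 1) :=
    fun _ => rfl
  -- A piece that contains the head has one further port, and otherwise there are two.
  have single : ∀ c, (∀ b : D.Region → ℕ, b (D.leftRegion (rot⁻¹ (s.dart c))) =
      b (D.leftRegion (s.dart c))) → ∃ c d, D.cornerRegion c (s.marker c - 1) = s.regionAt d ∧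
      D.cornerRegion d (s.marker d - 1) = s.regionAt c := by
    intro c h
    have := h fun r => if r = s.regionAt c then 1 else 0
    simp only [leftRegion_dart, hprev, if_true, ite_eq_left_iff, zero_ne_one, imp_false,
      not_not] at this
    exact ⟨c, c, this, this⟩
  rcases hport x (by simp [hports]) with rfl | ⟨c, rfl⟩ <;>
    rcases hport y (by simp [hports]) with rfl | ⟨d, rfl⟩
  · exact absurd rfl hxy
  · exact single d fun b => by simpa using hsum b
  · exact single c fun b => by simpa using hsum b
  · simp only [leftRegion_dart, hprev] at hsum
    have h1 := hsum fun r => if r = s.regionAt c then 1 else 0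
    by_cases hd : D.cornerRegion d (s.marker d - 1) = s.regionAt c
    · refine ⟨c, d, ?_, hd⟩
      have h2 := hsum fun r => if r = s.regionAt d then 1 else 0
      simp only [hd, if_true] at h2
      by_contra hc
      simp [hc, add_comm] at h2
    · refine ⟨c, c, ?_⟩
      by_contra hcc
      have hc : D.cornerRegion c (s.marker c - 1) ≠ s.regionAt c := fun h => hcc ⟨h, h⟩
      simp only [hd, hc, if_true, if_false] at h1
      omega

end ClockState

end OneLinkoidDiagram

namespace OneLinkoidDiagram

open LinkoidDart

variable {C : Type*} [Fintype C] {D : OneLinkoidDiagram C}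

/-! ### Existence of clock states, and heights -/

variable (D) in
/-- Hall's marriage theorem for crossings and unstarred regions. -/
theorem nonempty_clockState : Nonempty D.ClockState := by
  classical
  let t : C → Finset D.Region := fun c => (D.adjacentRegions {c}).erase D.starRegion
  obtain ⟨f, hf, hft⟩ := (Finset.all_card_le_biUnion_card_iff_exists_injective t).1 fun P => by
    rcases P.eq_empty_or_nonempty with rfl | hP
    · simp
    · have h1 : P.biUnion t = (D.adjacentRegions P).erase D.starRegion := by
        ext r
        simp only [t, Finset.mem_biUnion, Finset.mem_erase, mem_adjacentRegions,
          Finset.mem_singleton, exists_eq_left]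
        tauto
      have h2 := D.card_lt_card_adjacentRegions hP
      have h3 := Finset.pred_card_le_card_erase (s := D.adjacentRegions P) (a := D.starRegion)
      rw [h1]
      omega
  have hmem : ∀ c, f c ≠ D.starRegion ∧ ∃ i, D.cornerRegion c i = f c := by
    intro c
    simpa [t, mem_adjacentRegions] using hft c
  choose hstar m hm using hmem
  refine ⟨⟨m, fun c _ => ?_, fun c _ d _ h => hf ?_, fun r hr => ?_⟩⟩
  · change D.cornerRegion c (m c) ≠ D.starRegion
    rw [hm]; exact hstar c
  · change D.cornerRegion c (m c) = D.cornerRegion d (m d) at h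
    rwa [hm, hm] at h
  · -- There are just as many crossings as unstarred regions.
    have himage : Finset.univ.image f = Finset.univ.erase D.starRegion := by
      refine Finset.eq_of_subset_of_card_le (fun r hr => ?_) ?_
      · obtain ⟨c, -, rfl⟩ := Finset.mem_image.1 hr
        exact Finset.mem_erase.2 ⟨hstar c, Finset.mem_univ _⟩
      · rw [Finset.card_image_of_injective _ hf, Finset.card_erase_of_mem (Finset.mem_univ _),
          Finset.card_univ, Finset.card_univ, card_region]
        simp
    have : r ∈ Finset.univ.image f := by
      rw [himage]; exact Finset.mem_erase.2 ⟨hr, Finset.mem_univ _⟩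
    obtain ⟨c, -, rfl⟩ := Finset.mem_image.1 this
    exact ⟨c, Set.mem_univ c, hm c⟩

namespace ClockState

/-- The indicator function of the marked corners. -/
def mark (s : D.ClockState) : LinkoidDart C → ℚ
  | strand c i => if i = s.marker c then 1 else 0
  | _ => 0

variable (s t : D.ClockState)

theorem mark_strand (c : C) (i : ZMod 4) :
    s.mark (strand c i) = if i = s.marker c then 1 else 0 := rfl

theorem mark_of_isFree {d : LinkoidDart C} (hd : s.IsFree d) : s.mark d = 0 := by
  cases d with
  | strand c i => rw [mark_strand, if_neg (s.isFree_strand.1 hd)]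
  | _ => rfl

theorem mark_nonneg (d : LinkoidDart C) : 0 ≤ s.mark d := by
  cases d with
  | strand c i => rw [mark_strand]; split_ifs <;> simp
  | _ => exact le_rfl

theorem sum_mul_mark (g : LinkoidDart C → ℚ) : ∑ d, g d * s.mark d = ∑ c, g (s.dart c) := by
  rw [sum_eq]
  simp [mark, dart]

/-- The markers of every state occupy the unstarred regions once each. -/
theorem sum_regionAt (b : D.Region → ℚ) :
    ∑ c, b (s.regionAt c) = ∑ c, b (t.regionAt c) := by
  classical
  have h : ∀ s : D.ClockState, ∑ c, b (s.regionAt c) =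
      ∑ r ∈ Finset.univ.erase D.starRegion, b r := fun s => by
    refine Finset.sum_nbij s.regionAt (fun c _ => ?_) (s.regionAt_injective.injOn) (fun r hr => ?_)
      (fun _ _ => rfl)
    · exact Finset.mem_erase.2 ⟨s.regionAt_ne_star c, Finset.mem_univ _⟩
    · obtain ⟨c, hc⟩ := s.exists_regionAt_eq (Finset.mem_erase.1 hr).1
      exact ⟨c, by simp, hc⟩
  rw [h, h]

/-- `h` is a height function of the state `t` over the state `s`: a function on edges, vanishing
at the tail, whose jumps across corners are the differences of the markers. -/
structure IsHeight (h : LinkoidDart C → ℚ) : Prop where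
  apply_arc : ∀ d, h (D.arc d) = h d
  apply_tail : h tail = 0
  apply_rot : ∀ d, h (rot d) = h d + (t.mark d - s.mark d)

theorem exists_isHeight : ∃ h, IsHeight s t h := by
  obtain ⟨h, h1, h2, h3⟩ := D.exists_edge_potential (z := fun d => t.mark d - s.mark d)
    (fun a ha => by
      simp only [mul_sub, Finset.sum_sub_distrib, sum_mul_mark, dart]
      rw [sub_eq_zero]
      exact Finset.sum_congr rfl fun c _ => eq_of_comp_rot ha c _ _)
    (fun b => by
      simp only [mul_sub, Finset.sum_sub_distrib]
      rw [sum_mul_mark t (fun d => b (D.leftRegion d)), sum_mul_mark s (fun d => b (D.leftRegion d))]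
      exact sub_eq_zero.2 (sum_regionAt t s b))
  exact ⟨h, h1, h2, h3⟩

variable {s t} {h : LinkoidDart C → ℚ}

theorem IsHeight.symm (hh : IsHeight s t h) : IsHeight t s (-h) where
  apply_arc d := by simp [hh.apply_arc]
  apply_tail := by simp [hh.apply_tail]
  apply_rot d := by simp only [Pi.neg_apply, hh.apply_rot]; ring

theorem IsHeight.sub {r : D.ClockState} {k : LinkoidDart C → ℚ} (hh : IsHeight r s h)
    (hk : IsHeight r t k) : IsHeight s t (k - h) where
  apply_arc d := by simp [hh.apply_arc, hk.apply_arc]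
  apply_tail := by simp [hh.apply_tail, hk.apply_tail]
  apply_rot d := by simp only [Pi.sub_apply, hh.apply_rot, hk.apply_rot]; ring

theorem IsHeight.eq_of_eq_zero (hh : IsHeight s t h) (h0 : ∀ d, h d = 0) : s = t := by
  ext c
  have := hh.apply_rot (s.dart c)
  rw [h0, h0, dart, mark_strand, mark_strand, if_pos rfl] at this
  by_contra hne
  rw [if_neg hne] at this
  norm_num at this

/-- If no marker of `s` can be rotated clockwise, then no state has a positive height over `s`. -/
theorem IsHeight.nonpos (hh : IsHeight s t h)
    (hs : ∀ c d, D.cornerRegion c (s.marker c - 1) = s.regionAt d →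
      D.cornerRegion d (s.marker d - 1) ≠ s.regionAt c) (d : LinkoidDart C) : h d ≤ 0 := by
  by_contra hd
  have hA : s.IsForwardClosed {d | 0 < h d} :=
    { arc_mem := fun {d} hd => by simpa [hh.apply_arc] using hd
      rot_mem := fun {d} hd hf => by
        have h1 := t.mark_nonneg d
        simp only [Set.mem_ofPred_eq, hh.apply_rot, s.mark_of_isFree hf] at hd ⊢
        linarith }
  obtain ⟨c, d, h1, h2⟩ := exists_rotatable hA (by simp [hh.apply_tail]) ⟨d, not_le.1 hd⟩
  exact hs c d h1 h2

theorem eq_of_not_rotatable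
    (hs : ∀ c d, D.cornerRegion c (s.marker c - 1) = s.regionAt d →
      D.cornerRegion d (s.marker d - 1) ≠ s.regionAt c)
    (ht : ∀ c d, D.cornerRegion c (t.marker c - 1) = t.regionAt d →
      D.cornerRegion d (t.marker d - 1) ≠ t.regionAt c) : s = t := by
  obtain ⟨h, hh⟩ := exists_isHeight s t
  refine hh.eq_of_eq_zero fun d => le_antisymm (hh.nonpos hs d) ?_
  simpa using hh.symm.nonpos ht d

/-- Rotating markers clockwise by a quarter turn lowers the height nowhere. The crossings at edges of
negative height would otherwise violate the Hall condition. -/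
theorem IsHeight.nonneg (hh : IsHeight s t h)
    (hst : ∀ c, t.marker c = s.marker c ∨ t.marker c = s.marker c - 1) (d : LinkoidDart C) :
    0 ≤ h d := by
  classical
  by_contra hd
  rw [not_le] at hd
  let P : Finset C := Finset.univ.filter fun c => ∃ k, h (strand c k) < 0
  have hmemP : ∀ c, c ∈ P ↔ ∃ k, h (strand c k) < 0 := by simp [P]
  have hPne : P.Nonempty := by
    have hstrand : ∀ d, h d < 0 → d ≠ head → P.Nonempty := by
      rintro (_ | _ | ⟨c, k⟩) hd hne
      · exact absurd hh.apply_tail hd.ne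
      · exact absurd rfl hne
      · exact ⟨c, (hmemP c).2 ⟨k, hd⟩⟩
    by_cases hhead : d = head
    · exact hstrand (D.arc d) (by rwa [hh.apply_arc]) (hhead ▸ D.arc_ne head)
    · exact hstrand d hd hhead
  -- At a crossing of `P`, at most the edge under the rotated marker has nonnegative height.
  have hcorner : ∀ c ∈ P, ∀ k, h (strand c k) < 0 ∨ h (strand c (k + 1)) < 0 := by
    intro c hc k
    obtain ⟨j, hj⟩ := (hmemP c).1 hc
    have hrot : ∀ i, h (strand c (i + 1)) = h (strand c i) +
        ((if i = t.marker c then 1 else 0) - if i = s.marker c then 1 else 0) :=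
      fun i => hh.apply_rot (strand c i)
    rcases hst c with hm | hm
    · left
      have : ∀ i, h (strand c (i + 1)) = h (strand c i) := fun i => by rw [hrot, hm]; ring
      have e1 := this j
      have e2 := this (j + 1)
      have e3 := this (j + 1 + 1)
      rcases zmod_four_cases j k with rfl | rfl | rfl | rfl
      · exact hj
      · linarith
      · rw [show j + 2 = j + 1 + 1 by ring]; linarith
      · rw [show j + 3 = j + 1 + 1 + 1 by ring]; linarith
    · generalize s.marker c = m at hrot hm
      rw [hm] at hrot
      have e1 := hrot m
      have e2 := hrot (m + 1)
      have e3 := hrot (m + 2)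
      have n1 : m ≠ m - 1 := by rw [ne_comm, ne_eq, sub_eq_self]; decide
      have n2 : m + 1 ≠ m - 1 := by rw [ne_eq, eq_sub_iff_add_eq, add_assoc, add_eq_left]; decide
      have n3 : m + 1 ≠ m := by rw [ne_eq, add_eq_left]; decide
      have n4 : m + 2 ≠ m - 1 := by rw [ne_eq, eq_sub_iff_add_eq, add_assoc, add_eq_left]; decide
      have n5 : m + 2 ≠ m := by rw [ne_eq, add_eq_left]; decide
      rw [if_neg n1, if_pos rfl] at e1
      rw [if_neg n2, if_neg n3, show m + 1 + 1 = m + 2 by ring] at e2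
      rw [if_neg n4, if_neg n5, show m + 2 + 1 = m + 3 by ring] at e3
      have hv : h (strand c (m + 1)) < 0 := by
        rcases zmod_four_cases m j with rfl | rfl | rfl | rfl <;> linarith
      rcases zmod_four_cases m k with rfl | rfl | rfl | rfl
      · exact .inr hv
      · exact .inl hv
      · left; linarith
      · left; linarith
  have hwalk : ∀ n d, h d < 0 → (∃ c ∈ P, s.regionAt c = D.leftRegion d) ∨
      h ((facePerm D.arc)^[n] d) < 0 := by
    intro n
    induction n with
    | zero => exact fun d hd => .inr hd
    | succ n ih =>
      intro d hd
      have harc : h (rot (facePerm D.arc d)) < 0 := by rwa [rot_facePerm, hh.apply_arc]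
      by_cases hf : s.IsFree (facePerm D.arc d)
      · rw [Function.iterate_succ_apply, ← D.leftRegion_facePerm d]
        refine ih _ ?_
        rw [hh.apply_rot, s.mark_of_isFree hf] at harc
        have := t.mark_nonneg (facePerm D.arc d)
        linarith
      · simp only [IsFree, not_forall, not_not] at hf
        obtain ⟨c, hc⟩ := hf
        refine .inl ⟨c, (hmemP c).2 ⟨s.marker c + 1, ?_⟩, ?_⟩
        · rwa [hc] at harc
        · rw [← leftRegion_dart, ← hc, leftRegion_facePerm]
  have htouch : ∀ d, h d < 0 → ∃ c ∈ P, s.regionAt c = D.leftRegion d := by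
    intro d hd
    by_cases hstar : D.leftRegion d = D.starRegion
    · obtain ⟨n, hn⟩ := D.exists_iterate_facePerm (d := d) (e := tail) hstar
      refine (hwalk n d hd).resolve_right ?_
      rw [hn, hh.apply_tail]
      exact lt_irrefl _
    · obtain ⟨x, hx⟩ := s.exists_regionAt_eq hstar
      obtain ⟨n, hn⟩ := D.exists_iterate_facePerm (d := d) (e := s.dart x) hx.symm
      rcases hwalk n d hd with h' | h'
      · exact h'
      · exact ⟨x, (hmemP x).2 ⟨_, by rwa [hn] at h'⟩, hx⟩
  have hsub : D.adjacentRegions P ⊆ P.image s.regionAt := by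
    intro r hr
    obtain ⟨c, hc, k, rfl⟩ := D.mem_adjacentRegions.1 hr
    refine Finset.mem_image.2 ?_
    rcases hcorner c hc k with h' | h'
    · exact htouch _ h'
    · rw [cornerRegion, ← leftRegion_arc_rot]
      exact htouch _ (by rwa [hh.apply_arc])
  have := D.card_lt_card_adjacentRegions hPne
  have := (Finset.card_le_card hsub).trans Finset.card_image_le
  omega

theorem IsHeight.sum_pos (hh : IsHeight s t h)
    (hst : ∀ c, t.marker c = s.marker c ∨ t.marker c = s.marker c - 1) (hne : s ≠ t) :
    0 < ∑ d, h d := by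
  refine lt_of_le_of_ne (Finset.sum_nonneg fun d _ => hh.nonneg hst d) fun h0 => hne ?_
  have := (Finset.sum_eq_zero_iff_of_nonneg fun d _ => hh.nonneg hst d).1 h0.symm
  exact hh.eq_of_eq_zero fun d => this d (Finset.mem_univ d)

end ClockState

/-! ### Clock moves commute -/

namespace ClockState

/-- The markers at `c` and `d` turn by the angle `ε` and exchange their regions. When `c = d` this
says that one marker turns and stays in its region. -/
structure Turn (ε : ZMod 4) (s t : D.ClockState) (c d : C) : Prop where
  marker_left : t.marker c = s.marker c + ε
  marker_right : t.marker d = s.marker d + ε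
  marker_of_ne : ∀ x, x ≠ c → x ≠ d → t.marker x = s.marker x
  regionAt_left : t.regionAt c = s.regionAt d
  regionAt_right : t.regionAt d = s.regionAt c

variable {ε : ZMod 4} {s t u : D.ClockState} {c d e f : C}

theorem Turn.symm (h : Turn ε s t c d) : Turn ε s t d c :=
  ⟨h.marker_right, h.marker_left, fun x h1 h2 => h.marker_of_ne x h2 h1, h.regionAt_right,
    h.regionAt_left⟩

theorem Turn.reverse (h : Turn ε s t c d) : Turn (-ε) t s c d :=
  ⟨by simp [h.marker_left], by simp [h.marker_right], fun x h1 h2 => (h.marker_of_ne x h1 h2).symm,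
    h.regionAt_right.symm, h.regionAt_left.symm⟩

theorem regionAt_eq_of_marker_eq (h : t.marker c = s.marker c) : t.regionAt c = s.regionAt c := by
  rw [regionAt, h]; rfl

theorem exists_turn (h1 : D.cornerRegion c (s.marker c + ε) = s.regionAt d)
    (h2 : D.cornerRegion d (s.marker d + ε) = s.regionAt c) : ∃ t, Turn ε s t c d := by
  classical
  let m : C → ZMod 4 := fun x => if x = c ∨ x = d then s.marker x + ε else s.marker x
  have hm : ∀ x, D.cornerRegion x (m x) = s.regionAt (Equiv.swap c d x) := by
    intro x
    by_cases hc : x = c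
    · subst hc; simp [m, h1]
    · by_cases hd : x = d
      · subst hd; simp [m, h2]
      · simp [m, hc, hd, Equiv.swap_apply_of_ne_of_ne hc hd, regionAt]
  refine ⟨⟨m, ?_⟩, by simp [m], by simp [m], fun x h1 h2 => by simp [m, h1, h2], ?_, ?_⟩
  · simp only [hm]
    exact s.bijOn.comp (Equiv.swap c d).bijective.bijOn_univ
  · exact (hm c).trans (by simp)
  · exact (hm d).trans (by simp)

theorem Turn.det (h : Turn ε s t c d) (h' : Turn ε s u c d) : t = u := by
  ext x
  by_cases hc : x = c
  · rw [hc, h.marker_left, h'.marker_left]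
  · by_cases hd : x = d
    · rw [hd, h.marker_right, h'.marker_right]
    · rw [h.marker_of_ne x hc hd, h'.marker_of_ne x hc hd]

/-- The crossing with which a marker swaps its region is determined by the state. -/
theorem Turn.right_unique (h : Turn ε s t c d) (h' : Turn ε s u c f) : d = f := by
  refine s.regionAt_injective ?_
  rw [← h.regionAt_left, ← h'.regionAt_left, regionAt, regionAt, h.marker_left, h'.marker_left]

theorem Turn.marker_eq (h : Turn ε s t c d) (hc : c ≠ e) (hd : d ≠ e) :
    t.marker e = s.marker e := h.marker_of_ne e hc.symm hd.symm

/-- Two turns from one state are equal, or they take place at disjoint pairs of crossings and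
commute. -/
theorem Turn.comm (h : Turn ε s t c d) (h' : Turn ε s u e f) :
    (e = c ∧ f = d) ∨ (e = d ∧ f = c) ∨
      (c ≠ e ∧ c ≠ f ∧ d ≠ e ∧ d ≠ f ∧ ∃ v, Turn ε t v e f ∧ Turn ε u v c d) := by
  by_cases h1 : c = e
  · subst h1; exact .inl ⟨rfl, (h.right_unique h').symm⟩
  by_cases h2 : c = f
  · subst h2; exact .inr (.inl ⟨(h.right_unique h'.symm).symm, rfl⟩)
  by_cases h3 : d = e
  · subst h3; exact .inr (.inl ⟨rfl, (h.symm.right_unique h').symm⟩)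
  by_cases h4 : d = f
  · subst h4; exact .inl ⟨(h.symm.right_unique h'.symm).symm, rfl⟩
  refine .inr (.inr ⟨h1, h2, h3, h4, ?_⟩)
  -- A turn leaves the markers elsewhere in place, so that turns there stay possible.
  have key : ∀ {t u : D.ClockState} {c d e f : C}, Turn ε s t c d → Turn ε s u e f →
      c ≠ e → c ≠ f → d ≠ e → d ≠ f → ∃ v, Turn ε t v e f := by
    intro t u c d e f h h' h1 h2 h3 h4
    have m1 := h.marker_eq h1 h3
    have m2 := h.marker_eq h2 h4
    refine exists_turn ?_ ?_
    · rw [m1, regionAt_eq_of_marker_eq m2, ← h'.regionAt_left, regionAt, h'.marker_left]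
    · rw [m2, regionAt_eq_of_marker_eq m1, ← h'.regionAt_right, regionAt, h'.marker_right]
  obtain ⟨v, hv⟩ := key h h' h1 h2 h3 h4
  obtain ⟨w, hw⟩ := key h' h (Ne.symm h1) (Ne.symm h3) (Ne.symm h2) (Ne.symm h4)
  have hvw : w = v := by
    ext x
    by_cases hc : x = c
    · subst hc
      rw [hw.marker_left, hv.marker_of_ne _ h1 h2, h.marker_left, h'.marker_of_ne _ h1 h2]
    by_cases hd : x = d
    · subst hd
      rw [hw.marker_right, hv.marker_of_ne _ h3 h4, h.marker_right, h'.marker_of_ne _ h3 h4]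
    rw [hw.marker_of_ne x hc hd]
    by_cases he : x = e
    · subst he
      rw [hv.marker_left, h'.marker_left, h.marker_of_ne _ hc hd]
    by_cases hf : x = f
    · subst hf
      rw [hv.marker_right, h'.marker_right, h.marker_of_ne _ hc hd]
    rw [hv.marker_of_ne x he hf, h.marker_of_ne x hc hd, h'.marker_of_ne x he hf]
  exact ⟨v, hv, hvw ▸ hw⟩

end ClockState

/-! ### The lattice of clock states -/

variable [DecidableEq C] {s t : D.ClockState} {X : Finset (C × ZMod 4)}

open ClockState

/-- Both kinds of clockwise moves are turns by a negative quarter, at one crossing or at two. -/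
theorem clockwiseMove_iff : ClockwiseMove s t X ↔
    ∃ c d, Turn (-1) s t c d ∧ X = {(c, s.marker c), (d, s.marker d)} := by
  constructor
  · rintro (⟨c, rfl, hm, hr⟩ | ⟨c, d, -, rfl, hm, -, h1, h2⟩)
    · refine ⟨c, c, ⟨?_, ?_, fun x h _ => ?_, hr, hr⟩, by simp⟩
      · rw [hm, if_pos rfl, sub_eq_add_neg]
      · rw [hm, if_pos rfl, sub_eq_add_neg]
      · rw [hm, if_neg h]
    · refine ⟨c, d, ⟨?_, ?_, fun x h h' => ?_, h1, h2⟩, rfl⟩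
      · rw [hm, if_pos (.inl rfl), sub_eq_add_neg]
      · rw [hm, if_pos (.inr rfl), sub_eq_add_neg]
      · rw [hm, if_neg (by tauto)]
  · rintro ⟨c, d, h, rfl⟩
    by_cases hcd : c = d
    · subst hcd
      refine .inl ⟨c, by simp, fun x => ?_, h.regionAt_left⟩
      split_ifs with hx
      · rw [hx, h.marker_left, sub_eq_add_neg]
      · exact h.marker_of_ne x hx hx
    · refine .inr ⟨c, d, hcd, rfl, fun x => ?_, fun hr => hcd (s.regionAt_injective hr),
        h.regionAt_left, h.regionAt_right⟩
      split_ifs with hx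
      · rcases hx with rfl | rfl
        · rw [h.marker_left, sub_eq_add_neg]
        · rw [h.marker_right, sub_eq_add_neg]
      · rw [not_or] at hx
        exact h.marker_of_ne x hx.1 hx.2

theorem clockwiseMove_labelledDiamond :
    LabelledDiamond (fun s t : D.ClockState => ClockwiseMove s t) where
  det {s t u X} hst hsu := by
    obtain ⟨c, d, ht, rfl⟩ := clockwiseMove_iff.1 hst
    obtain ⟨e, f, hu, hX⟩ := clockwiseMove_iff.1 hsu
    have hc : ((c, s.marker c) : C × ZMod 4) ∈
        ({(e, s.marker e), (f, s.marker f)} : Finset (C × ZMod 4)) := by simp [← hX]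
    rcases ht.comm hu with ⟨rfl, rfl⟩ | ⟨rfl, rfl⟩ | ⟨h1, h2, -⟩
    · exact ht.det hu
    · exact ht.det hu.symm
    · simp [h1, h2] at hc
  comm {s t u X Y} hst hsu hXY := by
    obtain ⟨c, d, ht, rfl⟩ := clockwiseMove_iff.1 hst
    obtain ⟨e, f, hu, rfl⟩ := clockwiseMove_iff.1 hsu
    rcases ht.comm hu with ⟨rfl, rfl⟩ | ⟨rfl, rfl⟩ | ⟨h1, h2, h3, h4, v, hv, hw⟩
    · exact absurd rfl hXY
    · exact absurd (Finset.pair_comm _ _) hXY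
    · refine ⟨v, clockwiseMove_iff.2 ⟨e, f, hv, ?_⟩, clockwiseMove_iff.2 ⟨c, d, hw, ?_⟩⟩
      · rw [ht.marker_eq h1 h3, ht.marker_eq h2 h4]
      · rw [hu.marker_eq h1.symm h2.symm, hu.marker_eq h3.symm h4.symm]

theorem counterclockwiseMove_labelledDiamond :
    LabelledDiamond (fun s t : D.ClockState => fun X => ClockwiseMove t s X) where
  det {s t u X} hst hsu := by
    obtain ⟨c, d, ht, rfl⟩ := clockwiseMove_iff.1 hst
    obtain ⟨e, f, hu, hX⟩ := clockwiseMove_iff.1 hsu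
    have hc : ((c, t.marker c) : C × ZMod 4) ∈
        ({(e, u.marker e), (f, u.marker f)} : Finset (C × ZMod 4)) := by simp [← hX]
    rcases ht.reverse.comm hu.reverse with ⟨rfl, rfl⟩ | ⟨rfl, rfl⟩ | ⟨h1, h2, -⟩
    · exact ht.reverse.det hu.reverse
    · exact ht.reverse.det hu.reverse.symm
    · simp [h1, h2] at hc
  comm {s t u X Y} hst hsu hXY := by
    obtain ⟨c, d, ht, rfl⟩ := clockwiseMove_iff.1 hst
    obtain ⟨e, f, hu, rfl⟩ := clockwiseMove_iff.1 hsu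
    rcases ht.reverse.comm hu.reverse with ⟨rfl, rfl⟩ | ⟨rfl, rfl⟩ | ⟨h1, h2, h3, h4, v, hv, hw⟩
    · exact absurd (by rw [ht.reverse.det hu.reverse]) hXY
    · exact absurd (by rw [ht.reverse.det hu.reverse.symm, Finset.pair_comm]) hXY
    · have hv' := hv.reverse
      have hw' := hw.reverse
      rw [neg_neg] at hv' hw'
      refine ⟨v, clockwiseMove_iff.2 ⟨e, f, hv', ?_⟩, clockwiseMove_iff.2 ⟨c, d, hw', ?_⟩⟩
      · rw [hw.marker_eq h1 h3, hw.marker_eq h2 h4]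
      · rw [hv.marker_eq h1.symm h2.symm, hv.marker_eq h3.symm h4.symm]

theorem ClockwiseMove.marker_eq_or (h : ClockwiseMove s t X) (c : C) :
    t.marker c = s.marker c ∨ t.marker c = s.marker c - 1 := by
  obtain ⟨c', d, h, -⟩ := clockwiseMove_iff.1 h
  rw [sub_eq_add_neg]
  by_cases h1 : c = c'
  · subst h1; exact .inr h.marker_left
  by_cases h2 : c = d
  · subst h2; exact .inr h.marker_right
  exact .inl (h.marker_of_ne c h1 h2)

theorem ClockwiseMove.ne (h : ClockwiseMove s t X) : s ≠ t := by
  rintro rfl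
  obtain ⟨c, d, h, -⟩ := clockwiseMove_iff.1 h
  exact absurd (left_eq_add.1 h.marker_left) (by decide)

variable (D) in
/-- The total height over a fixed state increases with each clockwise move. -/
theorem exists_clockwise_rank :
    ∃ Φ : D.ClockState → ℚ, ∀ {s t X}, ClockwiseMove s t X → Φ s < Φ t := by
  obtain ⟨r⟩ := D.nonempty_clockState
  choose H hH using exists_isHeight r
  refine ⟨fun s => ∑ d, H s d, fun {s t X} h => ?_⟩
  have := ((hH s).sub (hH t)).sum_pos h.marker_eq_or h.ne
  simpa using this

theorem eq_of_no_clockwiseMove (hs : ∀ u X, ¬ ClockwiseMove s u X)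
    (ht : ∀ u X, ¬ ClockwiseMove t u X) : s = t := by
  have key : ∀ s : D.ClockState, (∀ u X, ¬ ClockwiseMove s u X) →
      ∀ c d, D.cornerRegion c (s.marker c - 1) = s.regionAt d →
        D.cornerRegion d (s.marker d - 1) ≠ s.regionAt c := by
    intro s hs c d h1 h2
    rw [sub_eq_add_neg] at h1 h2
    obtain ⟨u, hu⟩ := exists_turn h1 h2
    exact hs u _ (clockwiseMove_iff.2 ⟨c, d, hu, rfl⟩)
  exact eq_of_not_rotatable (key s hs) (key t ht)

instance : Finite D.ClockState :=
  Finite.of_injective (fun s : D.ClockState => s.marker) fun _ _ h => ClockState.ext h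

theorem reachedBy_iff {M : Multiset (Finset (C × ZMod 4))} :
    ReachedBy s t M ↔ LabelledPath ClockwiseMove s t M := by
  constructor
  · intro h
    induction h with
    | refl => exact .refl
    | step _ h ih => exact ih.snoc h
  · intro h
    induction h with
    | refl => exact .refl
    | snoc _ h ih => exact ih.step h

end OneLinkoidDiagram

theorem mainTheorem4 {C : Type*} [Fintype C] [DecidableEq C] (D : OneLinkoidDiagram C) :
    ∃ _ : Lattice D.ClockState,
      (∀ s₁ s₂ : D.ClockState, s₂ < s₁ ↔
        Relation.TransGen (fun s s' => ∃ X, OneLinkoidDiagram.ClockwiseMove s s' X) s₁ s₂) ∧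
      ∃ t b : D.ClockState,
        (∀ s : D.ClockState, s.IsClocked ↔ s = t) ∧
        (∀ s : D.ClockState, s.IsCounterClocked ↔ s = b) ∧
        IsTop t ∧ IsBot b ∧
        (∀ s : D.ClockState, ∃! M, OneLinkoidDiagram.ReachedBy t s M) ∧
        (∀ s₁ s₂ s : D.ClockState, OneLinkoidDiagram.IsMoveSup t s₁ s₂ s ↔ s = s₁ ⊔ s₂) ∧
        (∀ s₁ s₂ s : D.ClockState, OneLinkoidDiagram.IsMoveInf t s₁ s₂ s ↔ s = s₁ ⊓ s₂) := by
  obtain ⟨Φ, hΦ⟩ := D.exists_clockwise_rank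
  have := D.nonempty_clockState
  simp only [OneLinkoidDiagram.IsMoveSup, OneLinkoidDiagram.IsMoveInf,
    OneLinkoidDiagram.reachedBy_iff]
  exact exists_lattice_of_labelledDiamond OneLinkoidDiagram.clockwiseMove_labelledDiamond
    OneLinkoidDiagram.counterclockwiseMove_labelledDiamond hΦ
    fun s t => OneLinkoidDiagram.eq_of_no_clockwiseMove
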